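/- **(I) Matrix families.** Let $d,\bm r\ge 0$ be integers, let $A_i$ ($0\le i\le \bm r$) be real $N_i\times d$ matrices, and for $h\in\mathbb R$ put $$\mathcal A_h=\sum_{i=0}^{\bm r}h^{2i}\,{}^tA_iA_i={}^tB_hB_h,\qquad B_h=\begin{pmatrix}A_0\\ hA_1\\ \vdots\\ h^{\bm r}A_{\bm r}\end{pmatrix}.$$ Put $\mathcal V_{-1}=\{0\}$ and, for $0\le j\le \bm r$, $\mathcal V_j=\mathcal V_{j-1}+{}^tA_jA_j(\mathcal V_{j-1}^\perp)\subset\mathbb R^d$ (so $\mathcal V_0=\mathrm{Im}({}^tA_0A_0)$), and $n_j=\dim\mathcal V_j$, $n_{-1}=0$. Let $\hat A_j$ be the restriction of ${}^tA_jA_j$ to $\mathcal V_{j-1}^\perp$ as a self-adjoint operator, i.e. $\hat A_j v=Q_j\,{}^tA_jA_j v$ for $v\in\mathcal V_{j-1}^\perp$, where $Q_j$ is the orthogonal projection onto $\mathcal V_{j-1}^\perp$. Assume that $B_h$ has rank $d$ for all $h>0$. Then $n_{\bm r}=d$, and there are real analytic functions $\eta_i^j:\mathbb R\to\mathbb R$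 ($0\le j\le \bm r$, $1\le i\le n_j-n_{j-1}$) such that, for every $h\in\mathbb R$, the eigenvalues of $\mathcal A_h$, counted with multiplicity, are the $d$ numbers $$\lambda_i^j(h)=h^{2j}\eta_i^j(h),$$ and such that, for every $j$, the numbers $\eta_i^j(0)=\lim_{h\to0}\eta_i^j(h)$, $1\le i\le n_j-n_{j-1}$, are the non-zero eigenvalues of $\hat A_j$, counted with multiplicity. **(II) Approximating metrics.** Let $M$ be a smooth manifold of dimension $d$ and let $X^{01},\dots,X^{0N_0}$ be smooth vector fields on $M$. Let $\mathcal D_0$ be the $C^\infty(M)$-module of vector fields that they span, let $\mathcal D_{i+1}=\mathcal D_i+[\mathcal D_0,\mathcal D_i]$, let $\mathcal D_i(m)\subset T_mM$ be the space of values at $m$ of elements of $\mathcal D_i$, and let $n_i(m)=\dim\mathcal D_i(m)$, $n_{-1}(m)=0$. Assume that for every $m\in M$ there is a smallest integer $r(m)\ge0$ with $\mathcal D_{r(m)}(m)=T_mM$, and that $\bm r=\max_{m\in M}r(m)$ exists. Let $\mathcal C_0=\{1,\dots,N_0\}$ and, for $k\ge1$, let $\mathcal C_k$ be the set of multi-indices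 $I=(i_1,\dots,i_{k+1})\in\mathcal C_0^{k+1}$ whose iterated bracket $X_I=[X^{0i_1},[X^{0i_2},[\cdots,X^{0i_{k+1}}]\cdots]]$ is not identically zero on $M$. For $h>0$, $m\in M$, $v\in T_mM$ let $$g^h_m(v)=\inf\Big\{\sum_{k=0}^{\bm r}\sum_{I\in\mathcal C_k}(h^{-k}u_I)^2\ :\ u_I\in\mathbb R,\ \sum_{k=0}^{\bm r}\sum_{I\in\mathcal C_k}u_I\,X_I(m)=v\Big\},$$ a Euclidean quadratic form on $T_mM$. Let $x=(x_1,\dots,x_d)$ be smooth coordinates on an open set $U\subset M$, let $m\in U$, and let $\mathbb G_h$ be the Gram matrix of $g^h_m$ in the frame $(\partial/\partial x_1,\dots,\partial/\partial x_d)$ at $m$. Then $\mathbb G_h$ is positive definite for every $h>0$, $n_{\bm r}(m)=d$, and there are real analytic functions $\eta_i^j:\mathbb R\to\mathbb R$ ($0\le j\le\bm r$, $1\le i\le n_j(m)-n_{j-1}(m)$) with $\eta_i^j(0)\neq0$ such that, for every $h>0$, the eigenvalues of $\mathbb G_h^{-1}$, counted with multiplicity, are the $d$ numbers $\lambda_i^j(h)=h^{2j}\eta_i^j(h)$.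 -/

import Mathlib

open Polynomial Module
open scoped Manifold ContDiff Matrix Topology

noncomputable section

namespace SubRiemannian

/-- The successive increments `n_j - n_{j-1}` of a nondecreasing sequence, with `n_{-1} = 0`. -/
def increment (n : ℕ → ℕ) : ℕ → ℕ
  | 0 => n 0
  | j + 1 => n (j + 1) - n j

/-! ### Families of Gram matrices -/

section MatrixFamily

variable {d : ℕ} {N : ℕ → ℕ} (A : ∀ i, Matrix (Fin (N i)) (Fin d) ℝ)

/-- The matrix `∑_{i = 0}^r h^{2i} ᵗA_i A_i`. -/
def gramFamily (r : ℕ) (h : ℝ) : Matrix (Fin d) (Fin d) ℝ :=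
  ∑ i ∈ Finset.range (r + 1), h ^ (2 * i) • ((A i)ᵀ * A i)

/-- The stacked matrix `B_h`, with blocks `A_0, h A_1, …, h^r A_r` on top of each other. -/
def stackedMatrix (r : ℕ) (h : ℝ) : Matrix (Σ i : Fin (r + 1), Fin (N i)) (Fin d) ℝ :=
  Matrix.of fun p k => h ^ (p.1 : ℕ) * A p.1 p.2 k

/-- `ᵗA_j A_j` as an endomorphism of the Euclidean space `ℝ^d`. -/
def gramMap (j : ℕ) : EuclideanSpace ℝ (Fin d) →ₗ[ℝ] EuclideanSpace ℝ (Fin d) :=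
  Matrix.toEuclideanLin ((A j)ᵀ * A j)

/-- `V_0 = Im (ᵗA_0 A_0)`, `V_{j+1} = V_j + Im (ᵗA_{j+1} A_{j+1} restricted to V_j^⊥)`. -/
def V : ℕ → Submodule ℝ (EuclideanSpace ℝ (Fin d))
  | 0 => LinearMap.range (gramMap A 0)
  | j + 1 => V j ⊔ Submodule.map (gramMap A (j + 1)) (V j)ᗮ

/-- `V_{j-1}`, with `V_{-1} = 0`. -/
def prevV : ℕ → Submodule ℝ (EuclideanSpace ℝ (Fin d))
  | 0 => ⊥
  | j + 1 => V A j

/-- `n_j = dim V_j`. -/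
def dimV (j : ℕ) : ℕ := finrank ℝ (V A j)

/-- `Â_j`: the self-adjoint operator on `V_{j-1}^⊥` obtained by restricting `ᵗA_j A_j` to
`V_{j-1}^⊥` (that is, restricting its quadratic form: the value is projected orthogonally back
to `V_{j-1}^⊥`). -/
def hatA (j : ℕ) : ↥(prevV A j)ᗮ →ₗ[ℝ] ↥(prevV A j)ᗮ :=
  ((prevV A j)ᗮ.orthogonalProjectionOnto : EuclideanSpace ℝ (Fin d) →ₗ[ℝ] ↥(prevV A j)ᗮ) ∘ₗ
    gramMap A j ∘ₗ (prevV A j)ᗮ.subtype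

end MatrixFamily

/-! ### Sub-Riemannian structures defined by vector fields -/

section Structure

variable {d : ℕ} {M : Type*} [TopologicalSpace M] [ChartedSpace (EuclideanSpace ℝ (Fin d)) M]
  {N₀ : ℕ} (X : Fin N₀ → (m : M) → TangentSpace (𝓡 d) m)

/-- The `C^∞(M)`-module spanned by the vector fields `X^{0j}`. -/
def distribution₀ : Submodule ℝ ((m : M) → TangentSpace (𝓡 d) m) :=
  Submodule.span ℝ {W | ∃ (f : M → ℝ) (j : Fin N₀),
    ContMDiff (𝓡 d) 𝓘(ℝ, ℝ) ∞ f ∧ W = fun m => f m • X j m}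

/-- The distributions `D_0` and `D_{i+1} = D_i + [D_0, D_i]`, as spaces of vector fields. -/
def distribution : ℕ → Submodule ℝ ((m : M) → TangentSpace (𝓡 d) m)
  | 0 => distribution₀ X
  | i + 1 => distribution i ⊔ Submodule.span ℝ {W | ∃ Y ∈ distribution₀ X, ∃ Z ∈ distribution i,
      W = VectorField.mlieBracket (𝓡 d) Y Z}

/-- The subspace `D_i(m)` of the tangent space at `m`. -/
def distributionAt (i : ℕ) (m : M) : Submodule ℝ (TangentSpace (𝓡 d) m) :=
  Submodule.map (LinearMap.proj m) (distribution X i)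

/-- The growth vector `n_i(m) = dim D_i(m)`. -/
def growth (m : M) (i : ℕ) : ℕ := finrank ℝ (distributionAt X i m)

/-- `r(m)`: the smallest integer `k` with `D_k(m) = T_m M`. -/
def localStep (m : M) : ℕ := sInf {k | distributionAt X k m = ⊤}

/-- The iterated bracket `X_I = [X^{0 i_1}, [X^{0 i_2}, […, X^{0 i_{k+1}}]…]]`. -/
def iterBracket : (k : ℕ) → (Fin (k + 1) → Fin N₀) → (m : M) → TangentSpace (𝓡 d) m
  | 0, I => X (I 0)
  | k + 1, I => VectorField.mlieBracket (𝓡 d) (X (I 0)) (iterBracket k (Fin.tail I))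

/-- The index set `C_k`: all indices for `k = 0`; for `k ≥ 1` the multi-indices of length `k + 1`
whose bracket does not vanish identically. -/
def BracketIndex (k : ℕ) : Type :=
  {I : Fin (k + 1) → Fin N₀ // k = 0 ∨ ∃ m, iterBracket X k I m ≠ 0}

instance (k : ℕ) : Fintype (BracketIndex X k) := by
  classical
  unfold BracketIndex
  infer_instance

/-- The map `σ_m(u) = ∑_{i ≤ r} ∑_j u_{ij} X^{ij}_m`. -/
def sigmaMap (r : ℕ) (m : M) (u : (i : Fin (r + 1)) → BracketIndex X i → ℝ) :
    TangentSpace (𝓡 d) m :=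
  ∑ i : Fin (r + 1), ∑ j : BracketIndex X i, u i j • iterBracket X i j.1 m

/-- `|δ_h u|²`, the squared Euclidean norm of the dilated vector, `(δ_h u)_{ij} = h^{-i} u_{ij}`. -/
def dilatedNormSq (r : ℕ) (h : ℝ) (u : (i : Fin (r + 1)) → BracketIndex X i → ℝ) : ℝ :=
  ∑ i : Fin (r + 1), ∑ j : BracketIndex X i, (h⁻¹ ^ (i : ℕ) * u i j) ^ 2

/-- The Riemannian metric `g^h_m(v) = inf {|δ_h u|² : σ_m(u) = v}`, as a quadratic form. -/
def metric (r : ℕ) (h : ℝ) (m : M) (v : TangentSpace (𝓡 d) m) : ℝ :=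
  sInf {c | ∃ u, sigmaMap X r m u = v ∧ c = dilatedNormSq X r h u}

/-- The coordinate vector `∂/∂x_i` at `m` for the coordinates given by `x`: the preimage of the
`i`-th standard basis vector under the differential of `x`. -/
def coordVector (x : OpenPartialHomeomorph M (EuclideanSpace ℝ (Fin d))) (m : M) (i : Fin d) :
    TangentSpace (𝓡 d) m :=
  (mfderiv (𝓡 d) (𝓡 d) x m).inverse (EuclideanSpace.single i (1 : ℝ) : EuclideanSpace ℝ (Fin d))

/-- The Gram matrix of `g^h` at `m` in the coordinates `x`, by polarization of the
quadratic form: `(G_h)_{ij} = (g(∂_i + ∂_j) - g(∂_i) - g(∂_j)) / 2`. -/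
def metricMatrix (r : ℕ) (x : OpenPartialHomeomorph M (EuclideanSpace ℝ (Fin d))) (m : M)
    (h : ℝ) : Matrix (Fin d) (Fin d) ℝ :=
  Matrix.of fun i j =>
    QuadraticMap.polar (metric X r h m) (coordVector x m i) (coordVector x m j) / 2

end Structure

end SubRiemannian

end

noncomputable section

namespace SubRiemannian

/-! ### Monic polynomials with given lower coefficients -/

/-! Part (I) rests on positivity. Each `ᵗA_i A_i` is positive semidefinite, so the orthogonal
complement of `V_j` is the common kernel of `A_0, …, A_j` (`mem_V_orthogonal_iff`). Take an
orthonormal basis adapted to the flag, with `b_p` of weight `w p` in `V_{w p} ∩ V_{w p - 1}^⊥`. The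
term of index `i` contributes to the entry `(p, q)` only when `i ≥ max (w p) (w q)`. The matrix of
the family therefore has entries `h ^ (w p + w q) * m_{pq}(h)` with `m` polynomial in `h`. If each
graded block is diagonalized, `m(0)` is diagonal with nonzero entries.

The characteristic polynomial has coefficients polynomial in `h` and only real roots, so Rellich's
theorem (`exists_isRootsOn_univ`) gives root functions analytic on all of `ℝ`. Their orders and
leading coefficients at `0` remain to be found. `exists_equiv_order_leadingCoeff` evaluates the
characteristic polynomial at `h ^ (2j) * t`, removes the common power of `h` and lets `h → 0`. The
nonzero roots in `t` of the limit are the leading coefficients of the roots of order `2j`. Read off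
from `m`, they are the diagonal entries of weight `j`, that is, the nonzero eigenvalues of `Â_j`.

Rellich's theorem is local first, by induction on the degree. Translate so that the roots sum to
zero; the sum of their squares is then a nonnegative analytic function, of even order `2p` or
identically zero. Dividing the roots by `(h - h₀) ^ p` makes them not all equal at `h₀`, and
Hensel's lemma splits the polynomial into factors of smaller degree. Local choices are unique up to
a permutation, so they glue along the line.

In part (II), `g^h` is the value of a least-norm problem, so its Gram matrix is the inverse of the
matrix of part (I), where the rows of `A_k` are the coordinates of the brackets of length `k + 1`
(`metricMatrix_eq`). By the Leibniz rule these brackets span `D_j(m)`, so `dim V_j = n_j(m)` and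
part (I) applies. -/

/-- The polynomial of degree less than `n` with given coefficients. -/
def lowerPoly (n : ℕ) : (Fin n → ℝ) →ₗ[ℝ] ℝ[X] where
  toFun c := ∑ i, C (c i) * X ^ (i : ℕ)
  map_add' c c' := by simp [add_mul, Finset.sum_add_distrib]
  map_smul' r c := by simp [Finset.smul_sum, smul_eq_C_mul, mul_assoc]

lemma lowerPoly_apply {n : ℕ} (c : Fin n → ℝ) :
    lowerPoly n c = ∑ i, C (c i) * X ^ (i : ℕ) := rfl

lemma coeff_lowerPoly {n : ℕ} (c : Fin n → ℝ) (k : ℕ) :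
    (lowerPoly n c).coeff k = if h : k < n then c ⟨k, h⟩ else 0 := by
  rw [lowerPoly_apply, finsetSum_coeff]
  simp only [coeff_C_mul, coeff_X_pow]
  split_ifs with h
  · rw [Finset.sum_eq_single ⟨k, h⟩]
    · simp
    · intro i _ hi
      have : k ≠ i := fun e => hi (Fin.ext e.symm)
      simp [this]
    · simp
  · refine Finset.sum_eq_zero fun i _ => ?_
    have : k ≠ i := by have := i.2; omega
    simp [this]

lemma degree_lowerPoly_lt {n : ℕ} (c : Fin n → ℝ) : (lowerPoly n c).degree < n := by
  rw [degree_lt_iff_coeff_zero]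
  intro k hk
  rw [coeff_lowerPoly, dif_neg (by omega)]

lemma lowerPoly_coeff {n : ℕ} {p : ℝ[X]} (hp : p.degree < n) :
    lowerPoly n (fun i => p.coeff i) = p := by
  ext k
  rw [coeff_lowerPoly]
  split_ifs with h
  · rfl
  · exact ((degree_lt_iff_coeff_zero _ _).1 hp k (by omega)).symm

lemma lowerPoly_injective (n : ℕ) : Function.Injective (lowerPoly n) := by
  intro c c' h
  ext i
  have := congrArg (fun p => p.coeff i) h
  simpa [coeff_lowerPoly] using this

/-- The monic polynomial of degree `n` with given lower coefficients. -/
def monicPoly (n : ℕ) (c : Fin n → ℝ) : ℝ[X] := X ^ n + lowerPoly n c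

lemma monic_monicPoly {n : ℕ} (c : Fin n → ℝ) : (monicPoly n c).Monic :=
  monic_X_pow_add (degree_lowerPoly_lt c)

lemma natDegree_monicPoly {n : ℕ} (c : Fin n → ℝ) : (monicPoly n c).natDegree = n := by
  rw [monicPoly, natDegree_add_eq_left_of_degree_lt]
  · simp
  · simpa using degree_lowerPoly_lt c

lemma monicPoly_coeff {n : ℕ} {p : ℝ[X]} (hp : p.Monic) (hn : p.natDegree = n) :
    monicPoly n (fun i => p.coeff i) = p := by
  subst hn
  have h := lowerPoly_coeff (n := p.natDegree) (p := p - X ^ p.natDegree) (by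
    rw [← degree_eq_natDegree hp.ne_zero]
    exact degree_sub_lt_left (by rw [degree_X_pow, degree_eq_natDegree hp.ne_zero]) hp.ne_zero
      (by rw [hp.leadingCoeff, leadingCoeff_X_pow]))
  rw [monicPoly]
  have h2 : (fun i : Fin p.natDegree => (p - X ^ p.natDegree).coeff i) =
      fun i : Fin p.natDegree => p.coeff i := by
    ext i
    have : (i : ℕ) ≠ p.natDegree := i.2.ne
    simp [coeff_X_pow, this]
  rw [h2] at h
  rw [h]; ring

lemma coeff_monicPoly {n : ℕ} (c : Fin n → ℝ) (k : ℕ) :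
    (monicPoly n c).coeff k = (if k = n then 1 else 0) + if h : k < n then c ⟨k, h⟩ else 0 := by
  rw [monicPoly, coeff_add, coeff_X_pow, coeff_lowerPoly]

lemma contDiff_coeff_monicPoly (n k : ℕ) :
    ContDiff ℝ ω fun c : Fin n → ℝ => (monicPoly n c).coeff k := by
  simp only [coeff_monicPoly]
  refine contDiff_const.add ?_
  split_ifs with h
  · exact contDiff_apply ℝ ℝ _
  · exact contDiff_const

/-! ### Differential of multiplication, and Hensel's lemma -/

/-- The lower coefficients of the product of two monic polynomials. -/
def mulCoeffs (a b : ℕ) (p : (Fin a → ℝ) × (Fin b → ℝ)) : Fin (a + b) → ℝ :=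
  fun i => (monicPoly a p.1 * monicPoly b p.2).coeff i

lemma monicPoly_mulCoeffs {a b : ℕ} (p : (Fin a → ℝ) × (Fin b → ℝ)) :
    monicPoly (a + b) (mulCoeffs a b p) = monicPoly a p.1 * monicPoly b p.2 := by
  refine monicPoly_coeff ((monic_monicPoly _).mul (monic_monicPoly _)) ?_
  rw [(monic_monicPoly _).natDegree_mul (monic_monicPoly _), natDegree_monicPoly,
    natDegree_monicPoly]

lemma contDiff_mulCoeffs (a b : ℕ) : ContDiff ℝ ω (mulCoeffs a b) := by
  refine contDiff_pi.2 fun i => ?_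
  simp only [mulCoeffs, coeff_mul]
  refine ContDiff.sum fun x _ => ?_
  exact ((contDiff_coeff_monicPoly a _).comp contDiff_fst).mul
    ((contDiff_coeff_monicPoly b _).comp contDiff_snd)

/-- Along the line `p + t • q` the product is quadratic in `t`, and the derivative at `0` is its
linear coefficient. -/
lemma fderiv_mulCoeffs {a b : ℕ} (p q : (Fin a → ℝ) × (Fin b → ℝ)) (i : Fin (a + b)) :
    fderiv ℝ (mulCoeffs a b) p q i =
      (monicPoly a p.1 * lowerPoly b q.2 + lowerPoly a q.1 * monicPoly b p.2).coeff i := by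
  have hd : HasFDerivAt (mulCoeffs a b) (fderiv ℝ (mulCoeffs a b) p) p :=
    ((contDiff_mulCoeffs a b).differentiable (by simp) p).hasFDerivAt
  have hline : HasDerivAt (fun t : ℝ => p + t • q) q 0 := by
    simpa using ((hasDerivAt_id (0 : ℝ)).smul_const q).const_add p
  have h1 : HasDerivAt (fun t : ℝ => mulCoeffs a b (p + t • q)) (fderiv ℝ (mulCoeffs a b) p q) 0 := by
    have hd' : HasFDerivAt (mulCoeffs a b) (fderiv ℝ (mulCoeffs a b) p) (p + (0 : ℝ) • q) := by
      simpa using hd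
    exact hd'.comp_hasDerivAt 0 hline
  have h2 := hasDerivAt_pi.1 h1 i
  have h3 : (fun t : ℝ => mulCoeffs a b (p + t • q) i) = fun t : ℝ =>
      (monicPoly a p.1 * monicPoly b p.2).coeff i +
      t * (monicPoly a p.1 * lowerPoly b q.2 + lowerPoly a q.1 * monicPoly b p.2).coeff i +
      t ^ 2 * (lowerPoly a q.1 * lowerPoly b q.2).coeff i := by
    ext t
    rw [← coeff_C_mul, ← coeff_C_mul, ← coeff_add, ← coeff_add, mulCoeffs]
    congr 1
    simp only [monicPoly, Prod.fst_add, Prod.snd_add, Prod.smul_fst, Prod.smul_snd, map_add,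
      map_smul, smul_eq_C_mul, map_pow]
    ring
  rw [h3] at h2
  refine h2.unique ?_
  have := (((hasDerivAt_id (0 : ℝ)).mul_const
    ((monicPoly a p.1 * lowerPoly b q.2 + lowerPoly a q.1 * monicPoly b p.2).coeff i)).const_add
    ((monicPoly a p.1 * monicPoly b p.2).coeff i)).add
    ((hasDerivAt_pow 2 (0 : ℝ)).mul_const ((lowerPoly a q.1 * lowerPoly b q.2).coeff i))
  convert this using 1
  · ext t; simp
  · simp

/-- The Sylvester argument: if `U * v + u * V = 0` with `U`, `V` coprime, then `U` divides `u`,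
which has smaller degree, so `u = 0` and then `v = 0`. -/
lemma fderiv_mulCoeffs_injective {a b : ℕ} (p : (Fin a → ℝ) × (Fin b → ℝ))
    (hp : IsCoprime (monicPoly a p.1) (monicPoly b p.2)) :
    Function.Injective (fderiv ℝ (mulCoeffs a b) p) := by
  rw [injective_iff_map_eq_zero]
  intro q hq
  have h0 : monicPoly a p.1 * lowerPoly b q.2 + lowerPoly a q.1 * monicPoly b p.2 = 0 := by
    have hdeg : (monicPoly a p.1 * lowerPoly b q.2 +
        lowerPoly a q.1 * monicPoly b p.2).degree < (a + b : ℕ) := by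
      have ha : (monicPoly a p.1).degree = a := by
        rw [degree_eq_natDegree (monic_monicPoly _).ne_zero, natDegree_monicPoly]
      have hb : (monicPoly b p.2).degree = b := by
        rw [degree_eq_natDegree (monic_monicPoly _).ne_zero, natDegree_monicPoly]
      refine (degree_add_le _ _).trans_lt (max_lt ?_ ?_)
      · rw [degree_mul, ha, Nat.cast_add]
        exact WithBot.add_lt_add_left (WithBot.natCast_ne_bot _)
          (degree_lowerPoly_lt _)
      · rw [degree_mul, hb, Nat.cast_add]
        exact WithBot.add_lt_add_right (WithBot.natCast_ne_bot _)
          (degree_lowerPoly_lt _)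
    rw [← lowerPoly_coeff hdeg, ← map_zero (lowerPoly (a + b))]
    congr 1
    ext i
    rw [← fderiv_mulCoeffs, hq]
  have h1 : lowerPoly a q.1 = 0 := by
    refine eq_zero_of_dvd_of_degree_lt (p := monicPoly a p.1) ?_ ?_
    · refine hp.dvd_of_dvd_mul_right ?_
      rw [eq_neg_of_add_eq_zero_right h0]
      exact (dvd_mul_right _ _).neg_right
    · rw [degree_eq_natDegree (monic_monicPoly _).ne_zero, natDegree_monicPoly]
      exact degree_lowerPoly_lt _
  have h2 : lowerPoly b q.2 = 0 := by
    rw [h1, zero_mul, add_zero] at h0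
    exact (mul_eq_zero.1 h0).resolve_left (monic_monicPoly _).ne_zero
  exact Prod.ext (lowerPoly_injective a (by simpa using h1))
    (lowerPoly_injective b (by simpa using h2))

/-- Hensel's lemma for monic polynomials with analytic coefficients. -/
lemma exists_analyticAt_factorization {a b : ℕ} {c : ℝ → Fin (a + b) → ℝ} {h₀ : ℝ}
    (hc : AnalyticAt ℝ c h₀) (u₀ : Fin a → ℝ) (v₀ : Fin b → ℝ)
    (hcop : IsCoprime (monicPoly a u₀) (monicPoly b v₀))
    (hfac : monicPoly (a + b) (c h₀) = monicPoly a u₀ * monicPoly b v₀) :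
    ∃ (u : ℝ → Fin a → ℝ) (v : ℝ → Fin b → ℝ), AnalyticAt ℝ u h₀ ∧ AnalyticAt ℝ v h₀ ∧
      ∀ᶠ h in 𝓝 h₀, monicPoly (a + b) (c h) = monicPoly a (u h) * monicPoly b (v h) := by
  set p₀ : (Fin a → ℝ) × (Fin b → ℝ) := (u₀, v₀)
  have hinj := fderiv_mulCoeffs_injective p₀ hcop
  -- Source and target both have dimension `a + b`, so injectivity gives an isomorphism and the
  -- analytic inverse function theorem applies.
  let e : ((Fin a → ℝ) × (Fin b → ℝ)) ≃L[ℝ] (Fin (a + b) → ℝ) :=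
    (LinearMap.linearEquivOfInjective
      (fderiv ℝ (mulCoeffs a b) p₀ : _ →ₗ[ℝ] (Fin (a + b) → ℝ)) hinj
      (by simp)).toContinuousLinearEquiv
  have he : (e : _ →L[ℝ] (Fin (a + b) → ℝ)) = fderiv ℝ (mulCoeffs a b) p₀ := by
    exact ContinuousLinearMap.ext fun x => rfl
  have hcd : ContDiffAt ℝ ω (mulCoeffs a b) p₀ := (contDiff_mulCoeffs a b).contDiffAt
  have hs : HasStrictFDerivAt (mulCoeffs a b) (e : _ →L[ℝ] (Fin (a + b) → ℝ)) p₀ := by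
    rw [he]; exact hcd.hasStrictFDerivAt (by simp)
  have hc0 : c h₀ = mulCoeffs a b p₀ := by
    ext i
    have := congrArg (fun p => p.coeff i) (hfac.trans (monicPoly_mulCoeffs p₀).symm)
    have hi : (i : ℕ) ≠ a + b := i.2.ne
    simpa [coeff_monicPoly, hi] using this
  let g := hs.localInverse
  have hg : ContDiffAt ℝ ω g (mulCoeffs a b p₀) :=
    hcd.to_localInverse hs.hasFDerivAt (by simp)
  have hga : AnalyticAt ℝ (fun h => g (c h)) h₀ := by
    have hg' : AnalyticAt ℝ g (c h₀) := by rw [hc0]; exact hg.analyticAt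
    exact hg'.comp hc
  refine ⟨fun h => (g (c h)).1, fun h => (g (c h)).2, analyticAt_fst.comp hga,
    analyticAt_snd.comp hga, ?_⟩
  have hev := hs.eventually_right_inverse
  rw [← hc0] at hev
  filter_upwards [hc.continuousAt.eventually hev] with h hh
  rw [← monicPoly_mulCoeffs]
  exact congrArg _ hh.symm

/-! ### Real-rooted polynomials -/

/-- The monic polynomial with a given family of roots. -/
def rootsPoly {n : ℕ} (x : Fin n → ℝ) : ℝ[X] := ∏ i, (X - C (x i))

lemma monic_rootsPoly {n : ℕ} (x : Fin n → ℝ) : (rootsPoly x).Monic :=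
  monic_prod_of_monic _ _ fun i _ => monic_X_sub_C (x i)

lemma natDegree_rootsPoly {n : ℕ} (x : Fin n → ℝ) : (rootsPoly x).natDegree = n := by
  simp [rootsPoly]

lemma splits_rootsPoly {n : ℕ} (x : Fin n → ℝ) : (rootsPoly x).Splits :=
  Splits.prod fun i _ => Splits.X_sub_C (x i)

lemma exists_eq_rootsPoly {n : ℕ} {p : ℝ[X]} (hm : p.Monic) (hn : p.natDegree = n)
    (hs : p.Splits) : ∃ x : Fin n → ℝ, p = rootsPoly x := by
  have hcard : p.roots.toList.length = n := by
    rw [Multiset.length_toList, ← hs.natDegree_eq_card_roots, hn]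
  subst hcard
  refine ⟨fun i => p.roots.toList.get i, ?_⟩
  conv_lhs => rw [hs.eq_prod_roots_of_monic hm]
  rw [rootsPoly, ← List.prod_ofFn, ← Multiset.prod_coe]
  congr 1
  conv_lhs => rw [← Multiset.coe_toList p.roots, Multiset.map_coe]
  congr 1
  refine List.ext_get (by simp) fun i h1 h2 => by simp

/-- The coefficient of degree `k` is homogeneous of degree `n - k` in the roots. The substitution `X
↦ s X` proves this for `s ≠ 0` only. -/
lemma coeff_rootsPoly_mul {n : ℕ} (s : ℝ) (y : Fin n → ℝ) {k : ℕ} (hk : k ≤ n) :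
    (rootsPoly fun i => s * y i).coeff k = s ^ (n - k) * (rootsPoly y).coeff k := by
  rcases eq_or_ne s 0 with rfl | hs
  · have h0 : (rootsPoly fun i => 0 * y i) = X ^ n := by simp [rootsPoly]
    rw [h0, coeff_X_pow]
    rcases hk.eq_or_lt with rfl | hlt
    · have := (monic_rootsPoly y).coeff_natDegree
      rw [natDegree_rootsPoly] at this
      simp [this]
    · rw [if_neg hlt.ne, zero_pow (by omega), zero_mul]
  · have h1 : (rootsPoly fun i => s * y i).comp (C s * X) = C (s ^ n) * rootsPoly y := by
      simp only [rootsPoly, prod_comp, sub_comp, X_comp, C_comp, C_pow]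
      rw [← Fin.prod_const n (C s), ← Finset.prod_mul_distrib]
      exact Finset.prod_congr rfl fun i _ => by rw [C_mul]; ring
    have h2 := congrArg (fun p => p.coeff k) h1
    simp only [comp_C_mul_X_coeff, coeff_C_mul] at h2
    have h3 : s ^ n = s ^ (n - k) * s ^ k := by rw [← pow_add, Nat.sub_add_cancel hk]
    rw [h3] at h2
    have : s ^ k ≠ 0 := pow_ne_zero _ hs
    apply mul_right_cancel₀ this
    rw [h2]; ring

lemma rootsPoly_succ {n : ℕ} (x : Fin (n + 1) → ℝ) :
    rootsPoly x = (X - C (x 0)) * rootsPoly fun i : Fin n => x i.succ :=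
  Fin.prod_univ_succ _

lemma coeff_rootsPoly_pred {n : ℕ} (x : Fin (n + 1) → ℝ) :
    (rootsPoly x).coeff n = -∑ i, x i := by
  have := nextCoeff_of_natDegree_pos (p := rootsPoly x) (by rw [natDegree_rootsPoly]; omega)
  rw [natDegree_rootsPoly, Nat.add_sub_cancel] at this
  rw [← this]
  exact prod_X_sub_C_nextCoeff x

/-- Newton's identity for the second power sum. When the roots sum to zero, this single coefficient
controls the size of all of them. -/
lemma sum_sq_eq_coeff_rootsPoly {n : ℕ} (x : Fin (n + 2) → ℝ) :
    ∑ i, x i ^ 2 = (∑ i, x i) ^ 2 - 2 * (rootsPoly x).coeff n := by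
  induction n with
  | zero =>
    simp [rootsPoly, Fin.prod_univ_succ, Fin.sum_univ_succ, mul_coeff_zero]
    ring
  | succ n ih =>
    rw [rootsPoly_succ, Fin.sum_univ_succ, Fin.sum_univ_succ (f := x), ih, sub_mul, coeff_sub, coeff_X_mul,
      coeff_C_mul, coeff_rootsPoly_pred]
    ring

lemma continuous_coeff_rootsPoly (n k : ℕ) :
    Continuous fun x : Fin n → ℝ => (rootsPoly x).coeff k := by
  induction n generalizing k with
  | zero => simp only [rootsPoly, Finset.univ_eq_empty, Finset.prod_empty]; exact continuous_const
  | succ n ih =>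
    have h : Continuous fun x : Fin (n + 1) → ℝ => fun i : Fin n => x i.succ := by fun_prop
    cases k with
    | zero =>
      simp only [rootsPoly_succ, mul_coeff_zero, coeff_sub, coeff_X_zero, coeff_C_zero]
      exact (continuous_const.sub (continuous_apply 0)).mul ((ih 0).comp h)
    | succ k =>
      simp only [rootsPoly_succ, sub_mul, coeff_sub, coeff_X_mul, coeff_C_mul]
      exact ((ih k).comp h).sub ((continuous_apply 0).mul ((ih (k + 1)).comp h))

/-! ### Local analytic choice of roots -/

/-- If the order were `m < n`, the nonvanishing cofactor would be bounded by `K * |h - h₀| ^ (n -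
m)`, which tends to `0`. -/
lemma _root_.AnalyticAt.exists_eq_pow_mul_of_bound {f : ℝ → ℝ} {h₀ : ℝ} (hf : AnalyticAt ℝ f h₀)
    {n : ℕ} {K : ℝ} (hb : ∀ᶠ h in 𝓝[≠] h₀, |f h| ≤ K * |h - h₀| ^ n) :
    ∃ g : ℝ → ℝ, AnalyticAt ℝ g h₀ ∧ ∀ᶠ h in 𝓝 h₀, f h = (h - h₀) ^ n * g h := by
  suffices h : (n : ℕ∞) ≤ analyticOrderAt f h₀ by
    simpa using (natCast_le_analyticOrderAt hf).1 h
  by_contra hlt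
  push Not at hlt
  have htop : analyticOrderAt f h₀ ≠ ⊤ := ne_top_of_lt hlt
  obtain ⟨g, hg, hg0, hfg⟩ := hf.analyticOrderAt_ne_top.1 htop
  set m := analyticOrderNatAt f h₀
  have hm : m < n := by
    rw [← Nat.cast_analyticOrderNatAt htop] at hlt
    exact_mod_cast hlt
  apply hg0
  have h1 : Filter.Tendsto g (𝓝[≠] h₀) (𝓝 (g h₀)) := hg.continuousAt.continuousWithinAt
  have h2 : Filter.Tendsto (fun h => K * |h - h₀| ^ (n - m)) (𝓝[≠] h₀) (𝓝 0) := by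
    have : ContinuousAt (fun h => K * |h - h₀| ^ (n - m)) h₀ := by fun_prop
    have h3 := this.continuousWithinAt (s := {h₀}ᶜ)
    have h4 : n - m ≠ 0 := by omega
    simpa [ContinuousWithinAt, h4] using h3
  refine tendsto_nhds_unique h1 (squeeze_zero_norm' ?_ h2)
  filter_upwards [self_mem_nhdsWithin, hb,
    hfg.filter_mono nhdsWithin_le_nhds] with h hne hb hfg
  have hpos : 0 < |h - h₀| := abs_pos.2 (sub_ne_zero.2 hne)
  have hpow : 0 < |h - h₀| ^ m := pow_pos hpos m
  rw [hfg, smul_eq_mul, abs_mul, abs_pow] at hb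
  have h5 : |h - h₀| ^ n = |h - h₀| ^ m * |h - h₀| ^ (n - m) := by
    rw [← pow_add, Nat.add_sub_cancel' hm.le]
  rw [h5] at hb
  rw [Real.norm_eq_abs]
  refine le_of_mul_le_mul_left ?_ hpow
  linarith

/-- At a zero of odd order the function changes sign, so nonnegativity forces an even order. -/
lemma exists_eq_sq_pow_mul_of_nonneg {q : ℝ → ℝ} {h₀ : ℝ} (hq : AnalyticAt ℝ q h₀)
    (hnn : ∀ᶠ h in 𝓝 h₀, 0 ≤ q h) (hne : ¬ ∀ᶠ h in 𝓝 h₀, q h = 0) :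
    ∃ (p : ℕ) (g : ℝ → ℝ), AnalyticAt ℝ g h₀ ∧ g h₀ ≠ 0 ∧
      ∀ᶠ h in 𝓝 h₀, q h = ((h - h₀) ^ p) ^ 2 * g h := by
  obtain ⟨g, hg, hg0, hqg⟩ := hq.analyticOrderAt_ne_top.1 (mt analyticOrderAt_eq_top.1 hne)
  set m := analyticOrderNatAt q h₀
  rcases Nat.even_or_odd m with ⟨p, hp⟩ | hodd
  · refine ⟨p, g, hg, hg0, ?_⟩
    filter_upwards [hqg] with h hh
    rw [hh, hp, smul_eq_mul]; ring
  · exfalso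
    have hev : ∀ᶠ h in 𝓝 h₀, 0 ≤ (h - h₀) ^ m * g h := by
      filter_upwards [hnn, hqg] with h h1 h2
      rwa [h2] at h1
    apply hg0
    refine le_antisymm ?_ ?_
    · refine le_of_tendsto (hg.continuousAt.continuousWithinAt (s := Set.Iio h₀)) ?_
      filter_upwards [self_mem_nhdsWithin, hev.filter_mono nhdsWithin_le_nhds] with h h1 h2
      exact nonpos_of_mul_nonneg_right h2 (hodd.pow_neg (sub_neg.2 h1))
    · refine ge_of_tendsto (hg.continuousAt.continuousWithinAt (s := Set.Ioi h₀)) ?_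
      filter_upwards [self_mem_nhdsWithin, hev.filter_mono nhdsWithin_le_nhds] with h h1 h2
      exact nonneg_of_mul_nonneg_right h2 (pow_pos (sub_pos.2 h1) _)

/-- A family of monic polynomials, real-rooted near `h₀`, with coefficients analytic at `h₀`. -/
structure HyperbolicAt (n : ℕ) (P : ℝ → ℝ[X]) (h₀ : ℝ) : Prop where
  analyticAt : ∀ k, AnalyticAt ℝ (fun h => (P h).coeff k) h₀
  realRooted : ∀ᶠ h in 𝓝 h₀, ∃ x : Fin n → ℝ, P h = rootsPoly x

/-- The roots of the family are analytic functions near `h₀`. -/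
def HasAnalyticRootsAt (n : ℕ) (P : ℝ → ℝ[X]) (h₀ : ℝ) : Prop :=
  ∃ x : Fin n → ℝ → ℝ, (∀ i, AnalyticAt ℝ (x i) h₀) ∧
    ∀ᶠ h in 𝓝 h₀, P h = rootsPoly fun i => x i h

lemma HasAnalyticRootsAt.mul {a b : ℕ} {P U V : ℝ → ℝ[X]} {h₀ : ℝ}
    (hU : HasAnalyticRootsAt a U h₀) (hV : HasAnalyticRootsAt b V h₀)
    (hP : ∀ᶠ h in 𝓝 h₀, P h = U h * V h) : HasAnalyticRootsAt (a + b) P h₀ := by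
  obtain ⟨x, hx, hx'⟩ := hU
  obtain ⟨y, hy, hy'⟩ := hV
  refine ⟨Fin.append x y, fun i => ?_, ?_⟩
  · refine Fin.addCases (fun i => ?_) (fun i => ?_) i
    · simpa using hx i
    · simpa using hy i
  · filter_upwards [hP, hx', hy'] with h h1 h2 h3
    rw [h1, h2, h3, rootsPoly, rootsPoly, rootsPoly, Fin.prod_univ_add]
    simp

/-- If the roots at `h₀` are not all equal, the family splits into two families of smaller
degree. -/
lemma HyperbolicAt.exists_factorization {n : ℕ} {P : ℝ → ℝ[X]} {h₀ : ℝ} (hP : HyperbolicAt n P h₀)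
    {x : Fin n → ℝ} (hx : P h₀ = rootsPoly x) {i₀ j₀ : Fin n} (hij : x i₀ ≠ x j₀) :
    ∃ (a b : ℕ) (U V : ℝ → ℝ[X]), a < n ∧ b < n ∧ a + b = n ∧ HyperbolicAt a U h₀ ∧
      HyperbolicAt b V h₀ ∧ ∀ᶠ h in 𝓝 h₀, P h = U h * V h := by
  classical
  set s : Finset (Fin n) := Finset.univ.filter fun i => x i = x i₀ with hs
  set a := s.card with ha
  set b := sᶜ.card with hb
  have hab : a + b = n := by simp [ha, hb, Finset.card_add_card_compl]
  have hapos : 0 < a := Finset.card_pos.2 ⟨i₀, by simp [hs]⟩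
  have hbpos : 0 < b := Finset.card_pos.2 ⟨j₀, by simp [hs, Ne.symm hij]⟩
  set U₀ : ℝ[X] := ∏ i ∈ s, (X - C (x i)) with hU₀
  set V₀ : ℝ[X] := ∏ i ∈ sᶜ, (X - C (x i)) with hV₀
  have hU₀m : U₀.Monic := monic_prod_of_monic _ _ fun i _ => monic_X_sub_C (x i)
  have hV₀m : V₀.Monic := monic_prod_of_monic _ _ fun i _ => monic_X_sub_C (x i)
  have hU₀d : U₀.natDegree = a := by rw [hU₀, natDegree_finsetProd_X_sub_C_eq_card]
  have hV₀d : V₀.natDegree = b := by rw [hV₀, natDegree_finsetProd_X_sub_C_eq_card]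
  have hcop : IsCoprime U₀ V₀ := by
    refine IsCoprime.prod_left fun i hi => IsCoprime.prod_right fun j hj => ?_
    refine isCoprime_X_sub_C_of_isUnit_sub (IsUnit.mk0 _ (sub_ne_zero.2 fun h => ?_))
    simp only [hs, Finset.mem_filter, Finset.mem_univ, true_and, Finset.mem_compl] at hi hj
    exact hj (h ▸ hi)
  have hfac : P h₀ = U₀ * V₀ := by
    rw [hx, rootsPoly, hU₀, hV₀, Finset.prod_mul_prod_compl]
  have hPc : ∀ᶠ h in 𝓝 h₀, monicPoly (a + b) (fun i => (P h).coeff i) = P h := by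
    filter_upwards [hP.realRooted] with h ⟨y, hy⟩
    refine monicPoly_coeff ?_ ?_
    · rw [hy]; exact monic_rootsPoly y
    · rw [hy, natDegree_rootsPoly, hab]
  obtain ⟨u, v, hu, hv, huv⟩ := exists_analyticAt_factorization (a := a) (b := b) (h₀ := h₀)
    (c := fun h i => (P h).coeff i) (analyticAt_pi_iff.2 fun i => hP.analyticAt i)
    (fun i => U₀.coeff i) (fun i => V₀.coeff i)
    (by rwa [monicPoly_coeff hU₀m hU₀d, monicPoly_coeff hV₀m hV₀d])
    (by rw [monicPoly_coeff hU₀m hU₀d, monicPoly_coeff hV₀m hV₀d, hPc.self_of_nhds, hfac])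
  have hP' : ∀ᶠ h in 𝓝 h₀, P h = monicPoly a (u h) * monicPoly b (v h) := by
    filter_upwards [hPc, huv] with h h1 h2
    rw [← h1, h2]
  have hcoef : ∀ {m : ℕ} {w : ℝ → Fin m → ℝ}, AnalyticAt ℝ w h₀ → ∀ k,
      AnalyticAt ℝ (fun h => (monicPoly m (w h)).coeff k) h₀ := fun hw k =>
    (contDiff_coeff_monicPoly _ k).contDiffAt.analyticAt.comp hw
  refine ⟨a, b, fun h => monicPoly a (u h), fun h => monicPoly b (v h), by omega, by omega, hab,
    ⟨hcoef hu, ?_⟩, ⟨hcoef hv, ?_⟩, hP'⟩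
  · filter_upwards [hP', hP.realRooted] with h h1 ⟨y, hy⟩
    refine exists_eq_rootsPoly (monic_monicPoly _) (natDegree_monicPoly _) ?_
    refine (splits_rootsPoly y).of_dvd (monic_rootsPoly y).ne_zero ?_
    rw [← hy, h1]; exact dvd_mul_right _ _
  · filter_upwards [hP', hP.realRooted] with h h1 ⟨y, hy⟩
    refine exists_eq_rootsPoly (monic_monicPoly _) (natDegree_monicPoly _) ?_
    refine (splits_rootsPoly y).of_dvd (monic_rootsPoly y).ne_zero ?_
    rw [← hy, h1]; exact dvd_mul_left _ _

lemma rootsPoly_comp_add {n : ℕ} (x : Fin n → ℝ) (s : ℝ) :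
    (rootsPoly x).comp (X + C s) = rootsPoly fun i => x i - s := by
  simp only [rootsPoly, prod_comp, sub_comp, X_comp, C_comp, C_sub]
  exact Finset.prod_congr rfl fun i _ => by ring

lemma coeff_comp_X_add_C {p : ℝ[X]} {n : ℕ} (hp : p.natDegree ≤ n) (s : ℝ) (k : ℕ) :
    (p.comp (X + C s)).coeff k =
      ∑ i ∈ Finset.range (n + 1), p.coeff i * (s ^ (i - k) * (i.choose k : ℝ)) := by
  conv_lhs => rw [p.as_sum_range_C_mul_X_pow' (Nat.lt_succ_of_le hp)]
  rw [← coe_compRingHom_apply, map_sum, finsetSum_coeff]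
  refine Finset.sum_congr rfl fun i _ => ?_
  rw [coe_compRingHom_apply, mul_comp, C_comp, X_pow_comp, coeff_C_mul, coeff_X_add_C_pow]

lemma HyperbolicAt.comp_add {n : ℕ} {P : ℝ → ℝ[X]} {h₀ : ℝ} (hP : HyperbolicAt n P h₀)
    {s : ℝ → ℝ} (hs : AnalyticAt ℝ s h₀) :
    HyperbolicAt n (fun h => (P h).comp (X + C (s h))) h₀ := by
  refine ⟨fun k => ?_, ?_⟩
  · have h1 : AnalyticAt ℝ (fun h => ∑ i ∈ Finset.range (n + 1),
        (P h).coeff i * (s h ^ (i - k) * (i.choose k : ℝ))) h₀ := by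
      refine Finset.analyticAt_fun_sum _ fun i _ => ?_
      exact (hP.analyticAt i).mul ((hs.pow _).mul analyticAt_const)
    refine h1.congr ?_
    filter_upwards [hP.realRooted] with h ⟨x, hx⟩
    rw [coeff_comp_X_add_C]
    rw [hx, natDegree_rootsPoly]
  · filter_upwards [hP.realRooted] with h ⟨x, hx⟩
    exact ⟨_, by rw [hx, rootsPoly_comp_add]⟩

lemma HasAnalyticRootsAt.of_comp_add {n : ℕ} {P : ℝ → ℝ[X]} {h₀ : ℝ} {s : ℝ → ℝ}
    (hs : AnalyticAt ℝ s h₀)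
    (hP : HasAnalyticRootsAt n (fun h => (P h).comp (X + C (s h))) h₀) :
    HasAnalyticRootsAt n P h₀ := by
  obtain ⟨x, hx, hx'⟩ := hP
  refine ⟨fun i h => x i h - (-s h), fun i => (hx i).sub hs.neg, ?_⟩
  filter_upwards [hx'] with h hh
  rw [← rootsPoly_comp_add (fun i => x i h), ← hh, comp_assoc]
  simp

lemma eq_rootsPoly_of_coeff_le {n : ℕ} {p : ℝ[X]} (hp : p.natDegree ≤ n) {x : Fin n → ℝ}
    (h : ∀ k ≤ n, p.coeff k = (rootsPoly x).coeff k) : p = rootsPoly x := by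
  ext k
  rcases le_or_gt k n with hk | hk
  · exact h k hk
  · rw [coeff_eq_zero_of_natDegree_lt (hp.trans_lt hk), coeff_eq_zero_of_natDegree_lt]
    rwa [natDegree_rootsPoly]

/-- Here `-2 * coeff m` is the sum of the squares of the roots and has even order `2p`. The roots
divided by `(h - h₀) ^ p` stay bounded and keep sum zero, and their sum of squares has a nonzero
limit. So in the limit they cannot all coincide. -/
lemma HyperbolicAt.exists_rescaled {m : ℕ} {P : ℝ → ℝ[X]} {h₀ : ℝ}
    (hP : HyperbolicAt (m + 2) P h₀) (hc : ∀ᶠ h in 𝓝 h₀, (P h).coeff (m + 1) = 0)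
    (hne : ¬ ∀ᶠ h in 𝓝 h₀, (P h).coeff m = 0) :
    ∃ (p : ℕ) (R : ℝ → ℝ[X]) (y : Fin (m + 2) → ℝ), HyperbolicAt (m + 2) R h₀ ∧
      R h₀ = rootsPoly y ∧ (∃ i j, y i ≠ y j) ∧
      (∀ᶠ h in 𝓝 h₀, ∀ k ≤ m + 2,
        (P h).coeff k = ((h - h₀) ^ p) ^ (m + 2 - k) * (R h).coeff k) := by
  have hq : AnalyticAt ℝ (fun h => -2 * (P h).coeff m) h₀ := analyticAt_const.mul (hP.analyticAt m)
  have hsum : ∀ᶠ h in 𝓝 h₀, ∀ x : Fin (m + 2) → ℝ, P h = rootsPoly x →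
      ∑ i, x i = 0 ∧ ∑ i, x i ^ 2 = -2 * (P h).coeff m := by
    filter_upwards [hc] with h h1 x hx
    have h2 : ∑ i, x i = 0 := by
      rw [hx, coeff_rootsPoly_pred] at h1
      linarith
    refine ⟨h2, ?_⟩
    rw [sum_sq_eq_coeff_rootsPoly, h2, ← hx]; ring
  obtain ⟨p, g, hg, hg0, hqg⟩ := exists_eq_sq_pow_mul_of_nonneg hq
    (by
      filter_upwards [hsum, hP.realRooted] with h h1 ⟨x, hx⟩
      rw [← (h1 x hx).2]
      exact Finset.sum_nonneg fun i _ => sq_nonneg _)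
    (fun h => hne (h.mono fun h hh => by linarith))
  set G : ℝ := |g h₀| + 1
  have hgG : ∀ᶠ h in 𝓝 h₀, g h ≤ G := by
    have : g h₀ < G := by have := le_abs_self (g h₀); simp only [G]; linarith
    exact (hg.continuousAt.eventually (gt_mem_nhds this)).mono fun h hh => le_of_lt hh
  have hGpos : 0 ≤ G := by positivity
  -- A rescaled root has square at most `G`, hence absolute value at most `G + 1`.
  set B : Set (Fin (m + 2) → ℝ) := Metric.closedBall 0 (G + 1)
  have hB : IsCompact B := isCompact_closedBall _ _
  have hy : ∀ᶠ h in 𝓝[≠] h₀, ∃ y ∈ B, P h = rootsPoly (fun i => (h - h₀) ^ p * y i) ∧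
      ∑ i, y i = 0 ∧ ∑ i, y i ^ 2 = g h := by
    filter_upwards [self_mem_nhdsWithin, hsum.filter_mono nhdsWithin_le_nhds,
      hP.realRooted.filter_mono nhdsWithin_le_nhds, hqg.filter_mono nhdsWithin_le_nhds,
      hgG.filter_mono nhdsWithin_le_nhds] with h h1 h2 ⟨x, hx⟩ h3 h4
    have ht : (h - h₀) ^ p ≠ 0 := pow_ne_zero _ (sub_ne_zero.2 h1)
    obtain ⟨h5, h6⟩ := h2 x hx
    have h7 : ∑ i, (x i / (h - h₀) ^ p) ^ 2 = g h := by
      simp only [div_pow]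
      rw [← Finset.sum_div, h6, h3]
      field_simp
    refine ⟨fun i => x i / (h - h₀) ^ p, ?_, ?_, ?_, h7⟩
    · rw [mem_closedBall_zero_iff, pi_norm_le_iff_of_nonneg (by positivity)]
      intro i
      have h8 : (x i / (h - h₀) ^ p) ^ 2 ≤ G := by
        refine le_trans ?_ (h7.trans_le h4)
        exact Finset.single_le_sum (f := fun i => (x i / (h - h₀) ^ p) ^ 2)
          (fun i _ => sq_nonneg _) (Finset.mem_univ i)
      rw [Real.norm_eq_abs]
      refine abs_le_of_sq_le_sq (by nlinarith) (by positivity)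
    · rw [hx]; congr 1; ext i; field_simp
    · rw [← Finset.sum_div, h5, zero_div]
  -- Boundedness of the rescaled roots and homogeneity bound the coefficient of degree `k` by a
  -- multiple of `|h - h₀| ^ (p * (m + 2 - k))`, so it is divisible by that power.
  have hb : ∀ k : ℕ, k ≤ m + 2 → ∃ b : ℝ → ℝ, AnalyticAt ℝ b h₀ ∧
      ∀ᶠ h in 𝓝 h₀, (P h).coeff k = ((h - h₀) ^ p) ^ (m + 2 - k) * b h := by
    intro k hk
    obtain ⟨K, hK⟩ := hB.exists_bound_of_continuousOn
      (continuous_coeff_rootsPoly (m + 2) k).continuousOn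
    obtain ⟨b, hb, hb'⟩ := (hP.analyticAt k).exists_eq_pow_mul_of_bound (n := p * (m + 2 - k))
      (K := K) (by
        filter_upwards [hy] with h ⟨y, hyB, hy, _⟩
        rw [hy, coeff_rootsPoly_mul _ _ hk, abs_mul, ← pow_mul, abs_pow, mul_comm]
        exact mul_le_mul_of_nonneg_right (hK y hyB) (by positivity))
    refine ⟨b, hb, ?_⟩
    simpa only [pow_mul] using hb'
  choose! b hba hbP using hb
  set R : ℝ → ℝ[X] := fun h => ∑ k ∈ Finset.range (m + 2 + 1), C (b k h) * X ^ k with hR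
  have hRc : ∀ h, ∀ k ≤ m + 2, (R h).coeff k = b k h := by
    intro h k hk
    simp only [hR, finsetSum_coeff, coeff_C_mul_X_pow]
    rw [Finset.sum_ite_eq, if_pos (Finset.mem_range.2 (by omega))]
  have hRd : ∀ h, (R h).natDegree ≤ m + 2 := fun h =>
    natDegree_sum_le_of_forall_le _ _ fun k hk =>
      (natDegree_C_mul_X_pow_le _ _).trans (by have := Finset.mem_range.1 hk; omega)
  have hRa : ∀ k, AnalyticAt ℝ (fun h => (R h).coeff k) h₀ := by
    intro k
    rcases le_or_gt k (m + 2) with hk | hk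
    · simp only [hRc _ k hk]; exact hba k hk
    · simp only [coeff_eq_zero_of_natDegree_lt ((hRd _).trans_lt hk)]; exact analyticAt_const
  have hPR : ∀ᶠ h in 𝓝 h₀, ∀ k ≤ m + 2,
      (P h).coeff k = ((h - h₀) ^ p) ^ (m + 2 - k) * (R h).coeff k := by
    have : ∀ᶠ h in 𝓝 h₀, ∀ k ∈ Finset.range (m + 2 + 1),
        (P h).coeff k = ((h - h₀) ^ p) ^ (m + 2 - k) * b k h :=
      (Finset.eventually_all _).2 fun k hk => hbP k (by have := Finset.mem_range.1 hk; omega)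
    filter_upwards [this] with h hh k hk
    rw [hRc h k hk]
    exact hh k (Finset.mem_range.2 (by omega))
  have hyR : ∀ᶠ h in 𝓝[≠] h₀, ∃ y ∈ B, R h = rootsPoly y ∧ ∑ i, y i = 0 ∧ ∑ i, y i ^ 2 = g h := by
    filter_upwards [hy, hPR.filter_mono nhdsWithin_le_nhds, self_mem_nhdsWithin] with
      h ⟨y, hyB, h1, h2⟩ h3 h4
    refine ⟨y, hyB, eq_rootsPoly_of_coeff_le (hRd h) fun k hk => ?_, h2⟩
    have ht : ((h - h₀) ^ p) ^ (m + 2 - k) ≠ 0 := pow_ne_zero _ (pow_ne_zero _ (sub_ne_zero.2 h4))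
    apply mul_left_cancel₀ ht
    rw [← h3 k hk, h1, coeff_rootsPoly_mul _ _ hk]
  -- The rescaled roots are only available for `h ≠ h₀`. By compactness of `B` they have a limit
  -- along an ultrafilter, and the three continuous relations pass to it.
  obtain ⟨y, hyB, hyR0, hy0, hyg⟩ : ∃ y ∈ B, R h₀ = rootsPoly y ∧ ∑ i, y i = 0 ∧
      ∑ i, y i ^ 2 = g h₀ := by
    choose! z hzB hzR hz0 hzg using fun h => fun (H : ∃ y ∈ B, R h = rootsPoly y ∧
      ∑ i, y i = 0 ∧ ∑ i, y i ^ 2 = g h) => H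
    obtain ⟨y, hyB, hy⟩ := hB.exists_mapClusterPt (f := 𝓝[≠] h₀) (u := z)
      (Filter.tendsto_principal.2 (hyR.mono hzB))
    obtain ⟨U, hU, hUy⟩ := mapClusterPt_iff_ultrafilter.1 hy
    have hlim : ∀ {F : (Fin (m + 2) → ℝ) → ℝ} {G : ℝ → ℝ}, Continuous F → ContinuousAt G h₀ →
        (∀ᶠ h in 𝓝[≠] h₀, F (z h) = G h) → F y = G h₀ := by
      intro F G hF hG hFG
      refine tendsto_nhds_unique_of_eventuallyEq ((hF.tendsto y).comp hUy)
        (hG.tendsto.mono_left (hU.trans nhdsWithin_le_nhds)) (hU hFG)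
    refine ⟨y, hyB, eq_rootsPoly_of_coeff_le (hRd _) fun k _ => ?_, ?_, ?_⟩
    · exact (hlim (continuous_coeff_rootsPoly _ k) (hRa k).continuousAt
        (hyR.mono fun h hh => by rw [← hzR h hh])).symm
    · exact hlim (F := fun y => ∑ i, y i) (G := fun _ => 0) (by fun_prop) continuousAt_const
        (hyR.mono hz0)
    · exact hlim (F := fun y => ∑ i, y i ^ 2) (by fun_prop) hg.continuousAt (hyR.mono hzg)
  refine ⟨p, R, y, ⟨hRa, ?_⟩, hyR0, ?_, hPR⟩
  · rw [← nhdsNE_sup_pure, Filter.eventually_sup]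
    exact ⟨hyR.mono fun h ⟨y, _, hy, _⟩ => ⟨y, hy⟩, ⟨y, hyR0⟩⟩
  · by_contra hall
    push Not at hall
    have h1 : ∀ i, y i = 0 := by
      intro i
      have h2 : ∑ j, y j = ((m : ℝ) + 2) * y i := by
        rw [Finset.sum_congr rfl fun j _ => hall j i]; simp
      have h3 : ((m : ℝ) + 2) ≠ 0 := by positivity
      rw [hy0] at h2
      exact (mul_eq_zero.1 h2.symm).resolve_left h3
    exact hg0 (by rw [← hyg]; simp [h1])

/-- **Rellich's theorem**, local form: the roots of a real-rooted monic polynomial with analytic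
coefficients are analytic. -/
theorem HyperbolicAt.hasAnalyticRootsAt {n : ℕ} {P : ℝ → ℝ[X]} {h₀ : ℝ}
    (hP : HyperbolicAt n P h₀) : HasAnalyticRootsAt n P h₀ := by
  induction n using Nat.strong_induction_on generalizing P with
  | _ n ih =>
  match n, ih, hP with
  | 0, _, hP =>
    refine ⟨fun i => i.elim0, fun i => i.elim0, ?_⟩
    filter_upwards [hP.realRooted] with h ⟨x, hx⟩
    rw [hx]; simp [rootsPoly]
  | 1, _, hP =>
    refine ⟨fun _ h => -(P h).coeff 0, fun _ => (hP.analyticAt 0).neg, ?_⟩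
    filter_upwards [hP.realRooted] with h ⟨x, hx⟩
    rw [hx]; simp [rootsPoly]
  | m + 2, ih, hP =>
    -- The mean of the `m + 2` roots; translating by it kills the subleading coefficient.
    set s : ℝ → ℝ := fun h => -(P h).coeff (m + 1) / (m + 2) with hs
    have hsa : AnalyticAt ℝ s h₀ := by
      have := (hP.analyticAt (m + 1)).neg.mul (analyticAt_const (v := ((m : ℝ) + 2)⁻¹))
      exact this
    refine HasAnalyticRootsAt.of_comp_add hsa ?_
    have hQ := hP.comp_add hsa
    set Q : ℝ → ℝ[X] := fun h => (P h).comp (X + C (s h))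
    have hc : ∀ᶠ h in 𝓝 h₀, (Q h).coeff (m + 1) = 0 := by
      filter_upwards [hP.realRooted] with h ⟨x, hx⟩
      simp only [Q, hs]
      rw [hx, rootsPoly_comp_add, coeff_rootsPoly_pred, coeff_rootsPoly_pred,
        Finset.sum_sub_distrib]
      have : (m : ℝ) + 2 ≠ 0 := by positivity
      simp
      field_simp
      ring
    -- In this case the sum of squares vanishes near `h₀`, so all translated roots are zero.
    by_cases hz : ∀ᶠ h in 𝓝 h₀, (Q h).coeff m = 0
    · refine ⟨fun _ _ => 0, fun _ => analyticAt_const, ?_⟩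
      filter_upwards [hz, hc, hQ.realRooted] with h h1 h2 ⟨x, hx⟩
      have h3 : ∑ i, x i ^ 2 = 0 := by
        rw [hx, coeff_rootsPoly_pred] at h2
        rw [hx] at h1
        rw [sum_sq_eq_coeff_rootsPoly, h1, neg_eq_zero.1 h2]; simp
      rw [hx]
      congr 1
      ext i
      have := (Finset.sum_eq_zero_iff_of_nonneg fun i _ => sq_nonneg (x i)).1 h3 i
        (Finset.mem_univ i)
      exact pow_eq_zero_iff (two_ne_zero) |>.1 this
    · obtain ⟨p, R, y, hR, hy, ⟨i, j, hij⟩, hQR⟩ := hQ.exists_rescaled hc hz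
      obtain ⟨a, b, U, V, ha, hb, hab, hU, hV, hUV⟩ := hR.exists_factorization hy hij
      have hRr : HasAnalyticRootsAt (m + 2) R h₀ := by
        rw [← hab]
        exact (ih a ha hU).mul (ih b hb hV) hUV
      obtain ⟨ρ, hρ, hρ'⟩ := hRr
      refine ⟨fun i h => (h - h₀) ^ p * ρ i h, fun i => ?_, ?_⟩
      · exact ((analyticAt_id.sub analyticAt_const).pow p).mul (hρ i)
      · filter_upwards [hQR, hρ', hQ.realRooted] with h h1 h2 ⟨x, hx⟩
        refine eq_rootsPoly_of_coeff_le (by rw [hx, natDegree_rootsPoly]) fun k hk => ?_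
        rw [h1 k hk, h2, coeff_rootsPoly_mul _ _ hk]

/-- Equal multisets of values mean that corresponding fibres have the same cardinality. -/
lemma exists_equiv_of_map_univ_eq {ι κ α : Type*} [Fintype ι] [Fintype κ] {f : ι → α} {g : κ → α}
    (h : Multiset.map f Finset.univ.val = Multiset.map g Finset.univ.val) :
    ∃ e : ι ≃ κ, ∀ i, g (e i) = f i := by
  classical
  have hc : ∀ a, Nonempty ({i // f i = a} ≃ {k // g k = a}) := by
    intro a
    refine ⟨Fintype.equivOfCardEq ?_⟩
    have h1 := congrArg (Multiset.count a) h
    rw [Multiset.count_map, Multiset.count_map] at h1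
    rw [Fintype.card_subtype, Fintype.card_subtype]
    simpa [Finset.card, Finset.filter, eq_comm] using h1
  exact ⟨Equiv.ofFiberEquiv fun a => (hc a).some, fun i => Equiv.ofFiberEquiv_map _ i⟩

lemma exists_perm_of_rootsPoly_eq {n : ℕ} {x y : Fin n → ℝ} (h : rootsPoly x = rootsPoly y) :
    ∃ σ : Equiv.Perm (Fin n), ∀ i, y (σ i) = x i := by
  have hr : ∀ z : Fin n → ℝ, (rootsPoly z).roots = Multiset.map z Finset.univ.val := by
    intro z
    rw [← roots_multiset_prod_X_sub_C (Multiset.map z Finset.univ.val), Multiset.map_map]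
    rfl
  exact exists_equiv_of_map_univ_eq (by rw [← hr, ← hr, h])

/-! ### Global analytic choice of roots -/

/-- The functions `x i` are analytic on `U` and are the roots of `P` there. -/
structure IsRootsOn {n : ℕ} (P : ℝ → ℝ[X]) (x : Fin n → ℝ → ℝ) (U : Set ℝ) : Prop where
  analyticOnNhd : ∀ i, AnalyticOnNhd ℝ (x i) U
  eq_rootsPoly : ∀ h ∈ U, P h = rootsPoly fun i => x i h

section

variable {n : ℕ} {P : ℝ → ℝ[X]} {x y : Fin n → ℝ → ℝ} {U V : Set ℝ}

lemma IsRootsOn.mono (hx : IsRootsOn P x V) (h : U ⊆ V) : IsRootsOn P x U :=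
  ⟨fun i => (hx.analyticOnNhd i).mono h, fun t ht => hx.eq_rootsPoly t (h ht)⟩

/-- At each point the two choices agree up to a permutation. There are finitely many permutations,
so one of them works at points accumulating at `a`, and the identity theorem spreads it over `U`. -/
lemma IsRootsOn.exists_perm (hx : IsRootsOn P x U) (hy : IsRootsOn P y U) (hU : IsOpen U)
    (hUc : IsPreconnected U) (hne : U.Nonempty) :
    ∃ σ : Equiv.Perm (Fin n), ∀ i, Set.EqOn (x i) (y (σ i)) U := by
  obtain ⟨a, ha⟩ := hne
  have hfreq : ∃ σ : Equiv.Perm (Fin n), ∃ᶠ h in 𝓝[≠] a, ∀ i, x i h = y (σ i) h := by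
    by_contra hcon
    push Not at hcon
    have h1 : ∀ᶠ h in 𝓝[≠] a, ∀ σ : Equiv.Perm (Fin n), ¬ ∀ i, x i h = y (σ i) h :=
      Filter.eventually_all.2 fun σ => by simpa using hcon σ
    have h2 : ∀ᶠ h in 𝓝[≠] a, h ∈ U := (hU.mem_nhds ha : U ∈ 𝓝 a) |> mem_nhdsWithin_of_mem_nhds
    obtain ⟨h, h3, h4⟩ := (h1.and h2).exists
    obtain ⟨σ, hσ⟩ := exists_perm_of_rootsPoly_eq
      ((hx.eq_rootsPoly h h4).symm.trans (hy.eq_rootsPoly h h4))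
    exact h3 σ fun i => (hσ i).symm
  obtain ⟨σ, hσ⟩ := hfreq
  exact ⟨σ, fun i => (hx.analyticOnNhd i).eqOn_of_preconnected_of_frequently_eq
    (hy.analyticOnNhd (σ i)) hUc ha (hσ.mono fun h hh => hh i)⟩

/-- Gluing two analytic choices of roots on overlapping sets. -/
lemma IsRootsOn.exists_union (hx : IsRootsOn P x U) (hy : IsRootsOn P y V) (hU : IsOpen U)
    (hV : IsOpen V) (hc : IsPreconnected (U ∩ V)) (hne : (U ∩ V).Nonempty) :
    ∃ z : Fin n → ℝ → ℝ, IsRootsOn P z (U ∪ V) ∧ ∀ i, Set.EqOn (z i) (x i) U := by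
  classical
  obtain ⟨σ, hσ⟩ := (hx.mono Set.inter_subset_left).exists_perm
    (hy.mono Set.inter_subset_right) (hU.inter hV) hc hne
  have hxU : ∀ i, Set.EqOn (U.piecewise (x i) (y (σ i))) (x i) U := fun i =>
    Set.piecewise_eqOn _ _ _
  have hyV : ∀ i, Set.EqOn (U.piecewise (x i) (y (σ i))) (y (σ i)) V := by
    intro i h hh
    by_cases hhU : h ∈ U
    · rw [hxU i hhU, hσ i ⟨hhU, hh⟩]
    · exact Set.piecewise_eq_of_notMem _ _ _ hhU
  refine ⟨fun i => U.piecewise (x i) (y (σ i)), ⟨fun i h hh => ?_, fun h hh => ?_⟩, hxU⟩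
  · rcases hh with hh | hh
    · exact (hx.analyticOnNhd i h hh).congr
        (Filter.eventuallyEq_of_mem (hU.mem_nhds hh) fun t ht => (hxU i ht).symm)
    · exact (hy.analyticOnNhd (σ i) h hh).congr
        (Filter.eventuallyEq_of_mem (hV.mem_nhds hh) fun t ht => (hyV i ht).symm)
  · rcases hh with hh | hh
    · rw [hx.eq_rootsPoly h hh]
      congr 1; ext i; exact (hxU i hh).symm
    · rw [hy.eq_rootsPoly h hh, rootsPoly, ← Equiv.prod_comp σ]
      exact Finset.prod_congr rfl fun i _ => by rw [← hyV i hh]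

end

lemma HyperbolicAt.exists_isRootsOn_ball {n : ℕ} {P : ℝ → ℝ[X]} {h₀ : ℝ}
    (hP : HyperbolicAt n P h₀) :
    ∃ ε > 0, ∃ x : Fin n → ℝ → ℝ, IsRootsOn P x (Metric.ball h₀ ε) := by
  obtain ⟨x, hx, hx'⟩ := hP.hasAnalyticRootsAt
  have h1 : ∀ᶠ h in 𝓝 h₀, ∀ i, AnalyticAt ℝ (x i) h :=
    Filter.eventually_all.2 fun i => (hx i).eventually_analyticAt
  obtain ⟨ε, hε, h⟩ := Metric.eventually_nhds_iff_ball.1 (h1.and hx')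
  exact ⟨ε, hε, x, fun i h' hh => (h h' hh).1 i, fun h' hh => (h h' hh).2⟩

/-- **Rellich's theorem**: the roots of a family of real-rooted monic polynomials with analytic
coefficients on `ℝ` are analytic functions on `ℝ`. -/
theorem exists_isRootsOn_univ {n : ℕ} {P : ℝ → ℝ[X]} (hP : ∀ h, HyperbolicAt n P h) :
    ∃ x : Fin n → ℝ → ℝ, IsRootsOn P x Set.univ := by
  obtain ⟨ε₀, hε₀, x₀, hx₀⟩ := (hP 0).exists_isRootsOn_ball
  -- Prescribing the germ at `0` removes the permutation ambiguity, so solutions on nested intervals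
  -- agree and can be united.
  let E : ℝ → Prop := fun R => ∃ x : Fin n → ℝ → ℝ, IsRootsOn P x (Set.Ioo (-R) R) ∧
    ∀ i, x i =ᶠ[𝓝 0] x₀ i
  have hball : ∀ R : ℝ, Metric.ball (0 : ℝ) R = Set.Ioo (-R) R := fun R => by
    rw [Real.ball_eq_Ioo, zero_sub, zero_add]
  have hE₀ : E ε₀ := ⟨x₀, hball ε₀ ▸ hx₀, fun i => Filter.EventuallyEq.rfl⟩
  choose! x hx hx0 using fun R => fun (h : E R) => h
  have huniq : ∀ R R', E R → E R' → ∀ h, |h| < R → |h| < R' → ∀ i, x R i h = x R' i h := by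
    intro R R' hR hR' h h1 h2 i
    have h3 : 0 < min R R' := lt_min ((abs_nonneg h).trans_lt h1) ((abs_nonneg h).trans_lt h2)
    have hsub : ∀ S, min R R' ≤ S → Set.Ioo (-min R R') (min R R') ⊆ Set.Ioo (-S) S :=
      fun S hS => Set.Ioo_subset_Ioo (neg_le_neg hS) hS
    refine (((hx R hR).mono (hsub R (min_le_left _ _))).analyticOnNhd
      i).eqOn_of_preconnected_of_eventuallyEq
      (((hx R' hR').mono (hsub R' (min_le_right _ _))).analyticOnNhd i) isPreconnected_Ioo
      (z₀ := 0) ⟨by linarith, h3⟩ ((hx0 R hR i).trans (hx0 R' hR' i).symm) ?_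
    exact abs_lt.1 (lt_min h1 h2)
  obtain ⟨ρ, hρ⟩ : ∃ ρ : ℝ → ℝ, ∀ h, (∃ R, E R ∧ |h| < R) → E (ρ h) ∧ |h| < ρ h := by
    choose! ρ hρ using fun h => fun (H : ∃ R, E R ∧ |h| < R) => H
    exact ⟨ρ, hρ⟩
  let y : Fin n → ℝ → ℝ := fun i h => x (ρ h) i h
  have hy : ∀ R, E R → ∀ i, Set.EqOn (y i) (x R i) (Set.Ioo (-R) R) := by
    intro R hR i h hh
    have h1 := hρ h ⟨R, hR, abs_lt.2 hh⟩
    exact huniq _ _ h1.1 hR h h1.2 (abs_lt.2 hh) i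
  have hyr : ∀ U : Set ℝ, (∀ h ∈ U, ∃ R, E R ∧ |h| < R) → IsRootsOn P y U := by
    refine fun U hU => ⟨fun i h hh => ?_, fun h hh => ?_⟩
    · obtain ⟨R, hR, hhR⟩ := hU h hh
      have hm := abs_lt.1 hhR
      exact ((hx R hR).analyticOnNhd i h hm).congr
        (Filter.eventuallyEq_of_mem (isOpen_Ioo.mem_nhds hm) fun t ht => (hy R hR i ht).symm)
    · obtain ⟨R, hR, hhR⟩ := hU h hh
      rw [(hx R hR).eq_rootsPoly h (abs_lt.1 hhR)]
      congr 1; ext i; exact (hy R hR i (abs_lt.1 hhR)).symm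
  have hy0 : ∀ i, y i =ᶠ[𝓝 0] x₀ i := fun i =>
    (Filter.eventuallyEq_of_mem (Ioo_mem_nhds (by linarith) hε₀) (hy ε₀ hE₀ i)).trans
      (hx0 ε₀ hE₀ i)
  suffices hunb : ¬ BddAbove {R | E R} by
    refine ⟨y, hyr _ fun h _ => ?_⟩
    obtain ⟨R, hR, hhR⟩ := not_bddAbove_iff.1 hunb |h|
    exact ⟨R, hR, hhR⟩
  intro hbdd
  -- If the admissible radii were bounded, the solution on the maximal interval could be glued to
  -- local solutions at both endpoints, giving a larger radius.
  set R₀ := sSup {R | E R} with hR₀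
  have hR₀pos : 0 < R₀ := hε₀.trans_le (le_csSup hbdd hE₀)
  have hyR₀ : IsRootsOn P y (Set.Ioo (-R₀) R₀) := hyr _ fun h hh => by
    obtain ⟨R, hR, hhR⟩ := exists_lt_of_lt_csSup ⟨ε₀, hE₀⟩ (abs_lt.2 hh)
    exact ⟨R, hR, hhR⟩
  obtain ⟨ε₁, hε₁, u, hu⟩ := (hP R₀).exists_isRootsOn_ball
  obtain ⟨ε₂, hε₂, v, hv⟩ := (hP (-R₀)).exists_isRootsOn_ball
  rw [Real.ball_eq_Ioo] at hu hv
  obtain ⟨z, hz, hzy⟩ := hyR₀.exists_union hu isOpen_Ioo isOpen_Ioo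
    (by rw [Set.Ioo_inter_Ioo]; exact isPreconnected_Ioo)
    (by
      rw [Set.Ioo_inter_Ioo, Set.nonempty_Ioo]
      exact max_lt (lt_min (by linarith) (by linarith)) (lt_min (by linarith) (by linarith)))
  have hz' : IsRootsOn P z (Set.Ioo (-R₀) (R₀ + ε₁)) := hz.mono fun h hh => by
    by_cases h1 : h < R₀
    · exact Or.inl ⟨hh.1, h1⟩
    · exact Or.inr ⟨by linarith, hh.2⟩
  obtain ⟨w, hw, hwz⟩ := hz'.exists_union hv isOpen_Ioo isOpen_Ioo
    (by rw [Set.Ioo_inter_Ioo]; exact isPreconnected_Ioo)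
    (by
      rw [Set.Ioo_inter_Ioo, Set.nonempty_Ioo]
      exact max_lt (lt_min (by linarith) (by linarith)) (lt_min (by linarith) (by linarith)))
  have hnew : E (R₀ + min ε₁ ε₂) := by
    refine ⟨w, hw.mono fun h hh => ?_, fun i => ?_⟩
    · have h1 := min_le_left ε₁ ε₂
      have h2 := min_le_right ε₁ ε₂
      by_cases h3 : -R₀ < h
      · exact Or.inl ⟨h3, by linarith [hh.2]⟩
      · exact Or.inr ⟨by linarith [hh.1], by linarith⟩
    · refine Filter.EventuallyEq.trans ?_ (hy0 i)
      refine Filter.eventuallyEq_of_mem (Ioo_mem_nhds (neg_lt_zero.2 hR₀pos) hR₀pos) fun h hh => ?_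
      rw [hwz i ⟨hh.1, by linarith [hh.2]⟩, hzy i hh]
  have := le_csSup hbdd hnew
  have h3 : 0 < min ε₁ ε₂ := lt_min hε₁ hε₂
  linarith

/-! ### Orders and leading coefficients of the roots of a graded characteristic polynomial -/

/-- The limit as `h → 0` of `h ^ a * X - h ^ b * μ` divided by `h ^ min a b`. -/
def limitFactor (a b : ℕ) (μ : ℝ) : ℝ[X] :=
  C ((0 : ℝ) ^ (a - min a b)) * X - C ((0 : ℝ) ^ (b - min a b) * μ)

lemma limitFactor_of_lt {a b : ℕ} (h : b < a) (μ : ℝ) : limitFactor a b μ = -C μ := by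
  have : a - b ≠ 0 := by omega
  simp [limitFactor, min_eq_right h.le, this]

lemma limitFactor_self (a : ℕ) (μ : ℝ) : limitFactor a a μ = X - C μ := by
  simp [limitFactor]

lemma limitFactor_of_gt {a b : ℕ} (h : a < b) (μ : ℝ) : limitFactor a b μ = X := by
  have : b - a ≠ 0 := by omega
  simp [limitFactor, min_eq_left h.le, this]

lemma limitFactor_ne_zero (a b : ℕ) {μ : ℝ} (hμ : μ ≠ 0) : limitFactor a b μ ≠ 0 := by
  rcases lt_trichotomy a b with h | rfl | h
  · rw [limitFactor_of_gt h]; exact X_ne_zero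
  · rw [limitFactor_self]; exact X_sub_C_ne_zero μ
  · rw [limitFactor_of_lt h]; simpa using hμ

/-- The factor is a constant, `X - μ` or `X` according as `b < a`, `b = a` or `b > a`. So nonzero
roots detect exactly the order `a`. -/
lemma count_roots_limitFactor (a b : ℕ) {μ y : ℝ} (hy : y ≠ 0) :
    (limitFactor a b μ).roots.count y = if (b, μ) = (a, y) then 1 else 0 := by
  rcases lt_trichotomy a b with h | rfl | h
  · rw [limitFactor_of_gt h, roots_X]
    have : b ≠ a := by omega
    simp [this, hy]
  · rw [limitFactor_self, roots_X_sub_C]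
    simp [Multiset.count_singleton, eq_comm]
  · rw [limitFactor_of_lt h, ← C_neg, roots_C]
    have : b ≠ a := by omega
    simp [this]

lemma count_roots_prod_limitFactor {ι : Type*} [Fintype ι] (a : ℕ) (b : ι → ℕ) {μ : ι → ℝ}
    (hμ : ∀ p, μ p ≠ 0) {y : ℝ} (hy : y ≠ 0) :
    (∏ p, limitFactor a (b p) (μ p)).roots.count y =
      (Multiset.map (fun p => (b p, μ p)) Finset.univ.val).count (a, y) := by
  classical
  rw [roots_prod _ _ (Finset.prod_ne_zero_iff.2 fun p _ => limitFactor_ne_zero _ _ (hμ p)),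
    Multiset.count_bind, Multiset.count_map]
  simp only [count_roots_limitFactor _ _ hy]
  rw [← Multiset.countP_eq_card_filter, Multiset.countP_eq_card_filter]
  change ∑ p : ι, _ = _
  rw [Finset.sum_boole, Finset.card]
  simp [Finset.filter, eq_comm]

/-- Pull `h ^ min j (w p)` out of row `p` and column `p`. What remains is continuous at `0`, where
it is diagonal with entries the values of the limit factors. -/
lemma eval_charpoly_graded {ι : Type*} [Fintype ι] [DecidableEq ι] (w : ι → ℕ)
    (m : ℝ → Matrix ι ι ℝ) (hm : ContinuousAt m 0) {μ : ι → ℝ} (hμ : m 0 = Matrix.diagonal μ)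
    (j : ℕ) (t : ℝ) :
    ∃ D : ℝ → ℝ, ContinuousAt D 0 ∧ D 0 = (∏ p, limitFactor (2 * j) (2 * w p) (μ p)).eval t ∧
      ∀ h, (Matrix.of fun p q => h ^ (w p + w q) * m h p q).charpoly.eval (h ^ (2 * j) * t) =
        h ^ (∑ p, min (2 * j) (2 * w p)) * D h := by
  let c : ι → ℕ := fun p => min j (w p)
  have hc2 : ∀ p, min (2 * j) (2 * w p) = 2 * c p := fun p => by simp only [c]; omega
  let N : ℝ → Matrix ι ι ℝ := fun h => Matrix.diagonal (fun p => h ^ (2 * j - 2 * c p) * t) -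
    Matrix.of fun p q => h ^ ((w p - c p) + (w q - c q)) * m h p q
  refine ⟨fun h => (N h).det, ?_, ?_, ?_⟩
  · have hN : ContinuousAt N 0 := by
      refine ContinuousAt.sub ?_ ?_
      · have : Continuous fun h : ℝ =>
            Matrix.diagonal (fun p => h ^ (2 * j - 2 * c p) * t) := by
          apply Continuous.matrix_diagonal; fun_prop
        exact this.continuousAt
      · refine continuousAt_pi.2 fun p => continuousAt_pi.2 fun q => ?_
        have h1 : ContinuousAt (fun h => m h p q) 0 :=
          continuousAt_pi.1 (continuousAt_pi.1 hm p) q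
        exact (continuousAt_id.pow _).mul h1
    have hdet : Continuous fun A : Matrix ι ι ℝ => A.det := continuous_id.matrix_det
    exact hdet.continuousAt.comp hN
  · have hN0 : N 0 = Matrix.diagonal fun p => (limitFactor (2 * j) (2 * w p) (μ p)).eval t := by
      ext p q
      simp only [N, hμ, Matrix.sub_apply, Matrix.of_apply]
      rcases eq_or_ne p q with rfl | hpq
      · have : w p - c p + (w p - c p) = 2 * w p - 2 * c p := by simp only [c]; omega
        simp only [Matrix.diagonal_apply_eq, limitFactor, hc2, this]
        simp
      · simp [Matrix.diagonal_apply_ne _ hpq]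
    change (N 0).det = _
    rw [hN0, Matrix.det_diagonal, eval_prod]
  · intro h
    rw [Matrix.eval_charpoly]
    have hmat : Matrix.scalar ι (h ^ (2 * j) * t) -
        (Matrix.of fun p q => h ^ (w p + w q) * m h p q) =
        Matrix.diagonal (fun p => h ^ c p) * N h * Matrix.diagonal (fun p => h ^ c p) := by
      ext p q
      rw [Matrix.mul_diagonal, Matrix.diagonal_mul]
      simp only [N, Matrix.sub_apply, Matrix.of_apply, Matrix.scalar_apply]
      have hp : h ^ w p = h ^ c p * h ^ (w p - c p) := by
        rw [← pow_add]; congr 1; simp only [c]; omega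
      have hq : h ^ w q = h ^ c q * h ^ (w q - c q) := by
        rw [← pow_add]; congr 1; simp only [c]; omega
      rcases eq_or_ne p q with rfl | hpq
      · have h2 : h ^ (2 * j) = h ^ c p * h ^ c p * h ^ (2 * j - 2 * c p) := by
          rw [← pow_add, ← pow_add]; congr 1; simp only [c]; omega
        simp only [Matrix.diagonal_apply_eq]
        rw [pow_add, pow_add, hp, h2]; ring
      · simp only [Matrix.diagonal_apply_ne _ hpq]
        rw [pow_add, pow_add, hp, hq]; ring
    rw [hmat, Matrix.det_mul, Matrix.det_mul, Matrix.det_diagonal, Finset.prod_pow_eq_pow_sum]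
    simp only [hc2]
    rw [← Finset.mul_sum, two_mul, pow_add]
    ring

/-- The counterpart of `eval_charpoly_graded` for a polynomial given by its roots. -/
lemma eval_prod_graded {κ : Type*} [Fintype κ] (v : κ → ℕ) (ν : κ → ℝ → ℝ)
    (hν : ∀ k, ContinuousAt (ν k) 0) (a : ℕ) (t : ℝ) :
    ∃ D : ℝ → ℝ, ContinuousAt D 0 ∧ D 0 = (∏ k, limitFactor a (v k) (ν k 0)).eval t ∧
      ∀ h, (∏ k, (X - C (h ^ v k * ν k h))).eval (h ^ a * t) =
        h ^ (∑ k, min a (v k)) * D h := by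
  refine ⟨fun h => ∏ k, (h ^ (a - min a (v k)) * t - h ^ (v k - min a (v k)) * ν k h), ?_, ?_, ?_⟩
  · refine tendsto_finsetProd _ fun k _ => ?_
    exact ((continuousAt_id.pow _).mul continuousAt_const).sub ((continuousAt_id.pow _).mul (hν k))
  · rw [eval_prod]
    refine Finset.prod_congr rfl fun k _ => ?_
    simp [limitFactor]
  · intro h
    rw [eval_prod, ← Finset.prod_pow_eq_pow_sum, ← Finset.prod_mul_distrib]
    refine Finset.prod_congr rfl fun k _ => ?_
    have h1 : h ^ a = h ^ min a (v k) * h ^ (a - min a (v k)) := by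
      rw [← pow_add]; congr 1; omega
    have h2 : h ^ v k = h ^ min a (v k) * h ^ (v k - min a (v k)) := by
      rw [← pow_add]; congr 1; omega
    simp only [eval_sub, eval_X, eval_C]
    rw [h1, h2]; ring

lemma le_of_pow_mul_eventuallyEq {A B : ℕ} {f g : ℝ → ℝ} (hf : ContinuousAt f 0)
    (hg : ContinuousAt g 0) (hg0 : g 0 ≠ 0)
    (h : ∀ᶠ x in 𝓝[≠] (0 : ℝ), x ^ A * f x = x ^ B * g x) : A ≤ B := by
  by_contra hlt
  push Not at hlt
  have h1 : ContinuousAt (fun x : ℝ => x ^ (A - B) * f x) 0 := (continuousAt_id.pow _).mul hf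
  have h2 := tendsto_nhds_unique_of_eventuallyEq (l := 𝓝[≠] (0 : ℝ))
    h1.continuousWithinAt.tendsto hg.continuousWithinAt.tendsto (by
      filter_upwards [h, self_mem_nhdsWithin] with x hx hx0
      have h3 : x ^ B ≠ 0 := pow_ne_zero _ hx0
      apply mul_left_cancel₀ h3
      rw [← hx, ← mul_assoc, ← pow_add]
      congr 2; omega)
  apply hg0
  rw [← h2, zero_pow (by omega), zero_mul]

lemma prod_limitFactor_eq {ι κ : Type*} [Fintype ι] [Fintype κ] [DecidableEq ι] (w : ι → ℕ)
    (m : ℝ → Matrix ι ι ℝ) (hm : ContinuousAt m 0) {μ : ι → ℝ} (hμ : m 0 = Matrix.diagonal μ)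
    (hμ0 : ∀ p, μ p ≠ 0) (v : κ → ℕ) (ν : κ → ℝ → ℝ) (hν : ∀ k, ContinuousAt (ν k) 0)
    (hν0 : ∀ k, ν k 0 ≠ 0)
    (hP : ∀ᶠ h in 𝓝 0, (Matrix.of fun p q => h ^ (w p + w q) * m h p q).charpoly =
      ∏ k, (X - C (h ^ v k * ν k h))) (j : ℕ) :
    ∏ p, limitFactor (2 * j) (2 * w p) (μ p) = ∏ k, limitFactor (2 * j) (v k) (ν k 0) := by
  choose D hD hD0 hDe using eval_charpoly_graded w m hm hμ j
  choose D' hD' hD0' hDe' using eval_prod_graded v ν hν (2 * j)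
  set A := ∑ p, min (2 * j) (2 * w p)
  set B := ∑ k, min (2 * j) (v k)
  have heq : ∀ t, ∀ᶠ h in 𝓝[≠] (0 : ℝ), h ^ A * D t h = h ^ B * D' t h := by
    intro t
    filter_upwards [hP.filter_mono nhdsWithin_le_nhds] with h hh
    rw [← hDe, ← hDe', hh]
  have hL : ∏ p, limitFactor (2 * j) (2 * w p) (μ p) ≠ 0 :=
    Finset.prod_ne_zero_iff.2 fun p _ => limitFactor_ne_zero _ _ (hμ0 p)
  have hR : ∏ k, limitFactor (2 * j) (v k) (ν k 0) ≠ 0 :=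
    Finset.prod_ne_zero_iff.2 fun p _ => limitFactor_ne_zero _ _ (hν0 p)
  -- At a `t` where neither limit vanishes, comparing orders in `h` gives `A = B`. For every other
  -- `t` the powers then cancel and the limits agree.
  obtain ⟨t, ht⟩ : ∃ t, ((∏ p, limitFactor (2 * j) (2 * w p) (μ p)) *
      ∏ k, limitFactor (2 * j) (v k) (ν k 0)).eval t ≠ 0 := by
    by_contra hcon
    push Not at hcon
    exact mul_ne_zero hL hR (funext fun t => by simpa using hcon t)
  rw [eval_mul, ← hD0, ← hD0'] at ht
  have hAB : A = B := le_antisymm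
    (le_of_pow_mul_eventuallyEq (hD t) (hD' t) (right_ne_zero_of_mul ht) (heq t))
    (le_of_pow_mul_eventuallyEq (hD' t) (hD t) (left_ne_zero_of_mul ht)
      ((heq t).mono fun _ h => h.symm))
  refine funext fun t => ?_
  rw [← hD0, ← hD0']
  refine tendsto_nhds_unique_of_eventuallyEq (l := 𝓝[≠] (0 : ℝ))
    (hD t).continuousWithinAt.tendsto (hD' t).continuousWithinAt.tendsto ?_
  filter_upwards [heq t, self_mem_nhdsWithin] with h h1 h2
  rw [hAB] at h1
  exact mul_left_cancel₀ (pow_ne_zero _ h2) h1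

/-- If `m 0` is diagonal and invertible, then the eigenvalues of the matrix with entries
`h ^ (w p + w q) * m h p q` have order `2 * w p` and leading coefficient `m 0 p p`. -/
theorem exists_equiv_order_leadingCoeff {ι κ : Type*} [Fintype ι] [Fintype κ] [DecidableEq ι]
    (w : ι → ℕ) (m : ℝ → Matrix ι ι ℝ) (hm : ContinuousAt m 0) {μ : ι → ℝ}
    (hμ : m 0 = Matrix.diagonal μ) (hμ0 : ∀ p, μ p ≠ 0) (x : κ → ℝ → ℝ)
    (hx : ∀ k, AnalyticAt ℝ (x k) 0)
    (hP : ∀ᶠ h in 𝓝 0, (Matrix.of fun p q => h ^ (w p + w q) * m h p q).charpoly =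
      ∏ k, (X - C (x k h))) :
    ∃ (e : ι ≃ κ) (η : ι → ℝ → ℝ), (∀ p, AnalyticAt ℝ (η p) 0) ∧ (∀ p, η p 0 = μ p) ∧
      ∀ p, ∀ᶠ h in 𝓝 0, x (e p) h = h ^ (2 * w p) * η p h := by
  classical
  have hord : ∀ k, ∃ (v : ℕ) (ν : ℝ → ℝ), AnalyticAt ℝ ν 0 ∧ ν 0 ≠ 0 ∧
      ∀ᶠ h in 𝓝 0, x k h = h ^ v * ν h := by
    intro k
    have htop : analyticOrderAt (x k) 0 ≠ ⊤ := by
      rw [Ne, analyticOrderAt_eq_top]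
      intro hz
      -- With `j` above all weights and `t = 0`, every limit factor is the nonzero constant `-μ p`.
      -- So `0` is not a root for small `h ≠ 0`, and no root function vanishes identically.
      obtain ⟨D, hD, hD0, hDe⟩ := eval_charpoly_graded w m hm hμ (Finset.univ.sup w + 1) 0
      have hne : D 0 ≠ 0 := by
        rw [hD0, eval_prod]
        refine Finset.prod_ne_zero_iff.2 fun p _ => ?_
        have : w p ≤ Finset.univ.sup w := Finset.le_sup (Finset.mem_univ p)
        rw [limitFactor_of_lt (by omega)]
        simpa using hμ0 p
      have h1 : ∀ᶠ h in 𝓝[≠] (0 : ℝ), D h = 0 := by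
        filter_upwards [hP.filter_mono nhdsWithin_le_nhds, hz.filter_mono nhdsWithin_le_nhds,
          self_mem_nhdsWithin] with h h1 h2 h3
        have h4 := hDe h
        rw [h1, mul_zero, eval_prod, Finset.prod_eq_zero (Finset.mem_univ k) (by simp [h2])] at h4
        exact (mul_eq_zero.1 h4.symm).resolve_left (pow_ne_zero _ h3)
      have h2 : ∀ᶠ h in 𝓝[≠] (0 : ℝ), D h ≠ 0 :=
        (hD.eventually_ne hne).filter_mono nhdsWithin_le_nhds
      obtain ⟨h, h3, h4⟩ := (h1.and h2).exists
      exact h4 h3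
    obtain ⟨g, hg, hg0, hfg⟩ := (hx k).analyticOrderAt_ne_top.1 htop
    exact ⟨_, g, hg, hg0, by simpa using! hfg⟩
  choose v ν hν hν0 hxν using hord
  have hPν : ∀ᶠ h in 𝓝 0, (Matrix.of fun p q => h ^ (w p + w q) * m h p q).charpoly =
      ∏ k, (X - C (h ^ v k * ν k h)) := by
    filter_upwards [hP, Filter.eventually_all.2 hxν] with h h1 h2
    rw [h1]
    exact Finset.prod_congr rfl fun k _ => by rw [h2 k]
  have hcard : Fintype.card ι = Fintype.card κ := by
    have h1 := congrArg natDegree hP.self_of_nhds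
    rwa [Matrix.charpoly_natDegree_eq_dim, natDegree_prod_of_monic _ _
      fun k _ => monic_X_sub_C _, Finset.sum_congr rfl fun k _ => natDegree_X_sub_C _,
      Finset.sum_const, Finset.card_univ, smul_eq_mul, mul_one] at h1
  have hmap : Multiset.map (fun p => (2 * w p, μ p)) Finset.univ.val =
      Multiset.map (fun k => (v k, ν k 0)) Finset.univ.val := by
    -- As the cardinalities agree, it is enough to compare multiplicities of pairs in the left
    -- multiset. These have order `2 * w p` and nonzero second component, as counting roots
    -- requires.
    refine Multiset.eq_of_le_of_card_le (Multiset.le_iff_count.2 fun a => ?_) (by simp [hcard])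
    by_cases ha : a ∈ Multiset.map (fun p => (2 * w p, μ p)) Finset.univ.val
    · obtain ⟨p, -, rfl⟩ := Multiset.mem_map.1 ha
      rw [← count_roots_prod_limitFactor (2 * w p) (fun p => 2 * w p) hμ0 (hμ0 p),
        prod_limitFactor_eq w m hm hμ hμ0 v ν (fun k => (hν k).continuousAt) hν0 hPν,
        count_roots_prod_limitFactor (2 * w p) v hν0 (hμ0 p)]
    · rw [Multiset.count_eq_zero_of_notMem ha]; exact Nat.zero_le _
  obtain ⟨e, he⟩ := exists_equiv_of_map_univ_eq hmap
  refine ⟨e, fun p => ν (e p), fun p => hν _, fun p => congrArg Prod.snd (he p), fun p => ?_⟩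
  have h1 : v (e p) = 2 * w p := congrArg Prod.fst (he p)
  rw [← h1]
  exact hxν _

lemma exists_analyticOnNhd_of_eq_pow_mul {f g : ℝ → ℝ} {n : ℕ} (hf : AnalyticOnNhd ℝ f Set.univ)
    (hg : AnalyticAt ℝ g 0) (hfg : ∀ᶠ h in 𝓝 0, f h = h ^ n * g h) :
    ∃ η : ℝ → ℝ, AnalyticOnNhd ℝ η Set.univ ∧ η 0 = g 0 ∧ ∀ h, f h = h ^ n * η h := by
  classical
  -- The quotient is analytic away from `0`; the value `g 0` makes it equal to `g` near `0`.
  refine ⟨Function.update (fun h => f h / h ^ n) 0 (g 0), fun h _ => ?_, by simp, fun h => ?_⟩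
  · rcases eq_or_ne h 0 with rfl | hh
    · refine hg.congr ?_
      filter_upwards [hfg] with t ht
      rcases eq_or_ne t 0 with rfl | ht0
      · simp
      · rw [Function.update_of_ne ht0, ht]; field_simp
    · have h1 : AnalyticAt ℝ (fun h => f h / h ^ n) h :=
        (hf h trivial).div (analyticAt_id.pow n) (pow_ne_zero _ hh)
      refine h1.congr ?_
      filter_upwards [isOpen_ne.mem_nhds hh] with t ht
      rw [Function.update_of_ne ht]
  · rcases eq_or_ne h 0 with rfl | hh
    · rw [Function.update_self]; exact hfg.self_of_nhds
    · rw [Function.update_of_ne hh]; field_simp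

/-! ### The flag `V_j` -/

section MatrixFamily

variable {d : ℕ} {N : ℕ → ℕ} (A : ∀ i, Matrix (Fin (N i)) (Fin d) ℝ)

lemma inner_gramMap (j : ℕ) (v w : EuclideanSpace ℝ (Fin d)) :
    inner ℝ (gramMap A j v) w = (A j *ᵥ v.ofLp) ⬝ᵥ (A j *ᵥ w.ofLp) := by
  rw [gramMap, Matrix.toLpLin_apply, EuclideanSpace.inner_eq_star_dotProduct, star_trivial,
    ← Matrix.mulVec_mulVec, Matrix.dotProduct_mulVec, Matrix.vecMul_transpose,
    dotProduct_comm]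

lemma isSymmetric_gramMap (j : ℕ) : (gramMap A j).IsSymmetric := by
  intro v w
  rw [inner_gramMap, real_inner_comm, inner_gramMap, dotProduct_comm]

lemma gramMap_eq_zero_iff (j : ℕ) (v : EuclideanSpace ℝ (Fin d)) :
    gramMap A j v = 0 ↔ A j *ᵥ v.ofLp = 0 := by
  constructor
  · intro h
    have := inner_gramMap A j v v
    rw [h, inner_zero_left] at this
    exact dotProduct_self_eq_zero.1 this.symm
  · intro h
    rw [gramMap, Matrix.toLpLin_apply, ← Matrix.mulVec_mulVec, h, Matrix.mulVec_zero]
    rfl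

lemma inner_gramMap_self_eq_zero_iff (j : ℕ) (v : EuclideanSpace ℝ (Fin d)) :
    inner ℝ (gramMap A j v) v = 0 ↔ gramMap A j v = 0 := by
  rw [inner_gramMap, dotProduct_self_eq_zero, gramMap_eq_zero_iff]

/-- In the inductive step a vector `v` of `V_j^⊥` orthogonal to the image of `V_j^⊥` is in
particular orthogonal to its own image. By positivity `ᵗA_{j+1} A_{j+1} v = 0`. -/
lemma mem_V_orthogonal_iff (j : ℕ) (v : EuclideanSpace ℝ (Fin d)) :
    v ∈ (V A j)ᗮ ↔ ∀ i ≤ j, gramMap A i v = 0 := by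
  induction j with
  | zero =>
    rw [V, (isSymmetric_gramMap A 0).orthogonal_range, LinearMap.mem_ker]
    simp
  | succ j ih =>
    rw [V, ← Submodule.inf_orthogonal, Submodule.mem_inf, ih]
    constructor
    · rintro ⟨h1, h2⟩ i hi
      rcases hi.eq_or_lt with rfl | hi
      · rw [← inner_gramMap_self_eq_zero_iff]
        exact (Submodule.mem_orthogonal _ _).1 h2 _ (Submodule.mem_map_of_mem (ih.2 h1))
      · exact h1 i (by omega)
    · intro h
      refine ⟨fun i hi => h i (by omega), (Submodule.mem_orthogonal _ _).2 ?_⟩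
      rintro _ ⟨w, -, rfl⟩
      rw [isSymmetric_gramMap A (j + 1) w v, h _ le_rfl, inner_zero_right]

lemma mem_prevV_orthogonal_iff (j : ℕ) (v : EuclideanSpace ℝ (Fin d)) :
    v ∈ (prevV A j)ᗮ ↔ ∀ i < j, gramMap A i v = 0 := by
  cases j with
  | zero => simp [prevV]
  | succ j => rw [prevV, mem_V_orthogonal_iff]; simp only [Nat.lt_succ_iff]

lemma V_mono : Monotone (V A) := monotone_nat_of_le_succ fun _ => le_sup_left

lemma prevV_le_V (j : ℕ) : prevV A j ≤ V A j := by
  cases j with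
  | zero => exact bot_le
  | succ j => exact V_mono A j.le_succ

lemma V_le_prevV {i j : ℕ} (h : i < j) : V A i ≤ prevV A j := by
  cases j with
  | zero => omega
  | succ j => exact V_mono A (Nat.lt_succ_iff.1 h)

/-- The graded piece `V_j ∩ V_{j-1}^⊥`. -/
def gradedV (j : ℕ) : Submodule ℝ (EuclideanSpace ℝ (Fin d)) := (prevV A j)ᗮ ⊓ V A j

lemma finrank_gradedV (j : ℕ) : finrank ℝ (gradedV A j) = increment (dimV A) j := by
  have h : finrank ℝ (prevV A j) + finrank ℝ (gradedV A j) = finrank ℝ (V A j) :=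
    Submodule.finrank_add_inf_finrank_orthogonal (prevV_le_V A j)
  cases j with
  | zero =>
    have h0 : finrank ℝ (prevV A 0) = 0 := finrank_bot ℝ _
    rw [increment, dimV, ← h, h0, zero_add]
  | succ j => rw [increment, dimV, dimV, ← h, prevV, Nat.add_sub_cancel_left]

lemma orthogonalFamily_gradedV (r : ℕ) :
    OrthogonalFamily ℝ (fun j : Fin (r + 1) => gradedV A j)
      fun j => (gradedV A (j : ℕ)).subtypeₗᵢ := by
  have key : ∀ i j : ℕ, i < j → ∀ v ∈ gradedV A i, ∀ w ∈ gradedV A j, inner ℝ v w = 0 :=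
    fun i j hij v hv w hw => (Submodule.mem_orthogonal _ _).1 hw.1 v (V_le_prevV A hij hv.2)
  intro i j hij v w
  rcases lt_or_gt_of_ne hij with h | h
  · exact key i j h v v.2 w w.2
  · rw [real_inner_comm]
    exact key j i h w w.2 v v.2

lemma V_le_iSup_gradedV (r : ℕ) : V A r ≤ ⨆ j : Fin (r + 1), gradedV A j := by
  have key : ∀ j ≤ r, V A j ≤ ⨆ j : Fin (r + 1), gradedV A j := by
    intro j hj
    induction j with
    | zero =>
      refine le_trans ?_ (le_iSup (fun j : Fin (r + 1) => gradedV A j) 0)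
      simp [gradedV, prevV]
    | succ j ih =>
      rw [← Submodule.sup_orthogonal_inf_of_hasOrthogonalProjection (prevV_le_V A (j + 1))]
      exact sup_le (ih (by omega))
        (le_iSup (fun j : Fin (r + 1) => gradedV A j) ⟨j + 1, by omega⟩)
  exact key r le_rfl

lemma isInternal_gradedV {r : ℕ} (hr : V A r = ⊤) :
    DirectSum.IsInternal fun j : Fin (r + 1) => gradedV A j := by
  rw [(orthogonalFamily_gradedV A r).isInternal_iff, Submodule.orthogonal_eq_bot_iff, eq_top_iff,
    ← hr]
  exact V_le_iSup_gradedV A r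

/-- The compression of `ᵗA_j A_j` to the graded piece. -/
def gradedMap (j : ℕ) : gradedV A j →ₗ[ℝ] gradedV A j :=
  ((gradedV A j).orthogonalProjectionOnto : EuclideanSpace ℝ (Fin d) →ₗ[ℝ] gradedV A j) ∘ₗ
    gramMap A j ∘ₗ (gradedV A j).subtype

lemma inner_gradedMap (j : ℕ) (v w : gradedV A j) :
    inner ℝ (gradedMap A j v) w = inner ℝ (gramMap A j v) (w : EuclideanSpace ℝ (Fin d)) :=
  Submodule.inner_orthogonalProjectionOnto_eq_of_mem_right w _

lemma isSymmetric_gradedMap (j : ℕ) : (gradedMap A j).IsSymmetric := by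
  intro v w
  rw [inner_gradedMap, ← real_inner_comm v (gradedMap A j w), inner_gradedMap, isSymmetric_gramMap,
    real_inner_comm]

/-- The index set of a basis adapted to the flag. -/
abbrev FlagIndex (r : ℕ) : Type := Σ j : Fin (r + 1), Fin (increment (dimV A) j)

lemma exists_adapted_basis {r : ℕ} (hr : V A r = ⊤) :
    ∃ (b : OrthonormalBasis (FlagIndex A r) ℝ (EuclideanSpace ℝ (Fin d)))
      (μ : FlagIndex A r → ℝ), (∀ p, b p ∈ gradedV A p.1) ∧ (∀ p, μ p ≠ 0) ∧
      ∀ p q, p.1 = q.1 → inner ℝ (gramMap A q.1 (b q)) (b p) = if p = q then μ p else 0 := by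
  let u : ∀ j : Fin (r + 1), OrthonormalBasis (Fin (increment (dimV A) j)) ℝ (gradedV A j) :=
    fun j => (isSymmetric_gradedMap A j).eigenvectorBasis (finrank_gradedV A j)
  let μ : FlagIndex A r → ℝ := fun p =>
    (isSymmetric_gradedMap A p.1).eigenvalues (finrank_gradedV A p.1) p.2
  let b := (isInternal_gradedV A hr).collectedOrthonormalBasis (orthogonalFamily_gradedV A r) u
  have hb : ∀ p, b p = (u p.1 p.2 : EuclideanSpace ℝ (Fin d)) := by
    intro p
    simp [b, DirectSum.IsInternal.collectedOrthonormalBasis]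
  have hin : ∀ p q : FlagIndex A r, p.1 = q.1 →
      inner ℝ (gramMap A q.1 (b q)) (b p) = if p = q then μ p else 0 := by
    rintro ⟨j, i⟩ ⟨j', i'⟩ h
    obtain rfl : j = j' := h
    rw [hb, hb, ← inner_gradedMap]
    simp only [u, LinearMap.IsSymmetric.apply_eigenvectorBasis]
    rw [real_inner_smul_left, orthonormal_iff_ite.1
      ((isSymmetric_gradedMap A j).eigenvectorBasis (finrank_gradedV A j)).orthonormal]
    by_cases hi : i = i'
    · subst hi; simp [μ]
    · simp [hi, Ne.symm hi]
  have hmem : ∀ p, b p ∈ gradedV A p.1 := fun p => by rw [hb]; exact (u p.1 p.2).2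
  refine ⟨b, μ, hmem, fun p hp => ?_, hin⟩
  -- If `μ p = 0`, positivity puts `b p` in the kernel of `ᵗA_j A_j` with `j = p.1`. The lower maps
  -- kill it too, so `b p` lies in `V_j ∩ V_j^⊥ = 0`.
  have h1 := hin p p rfl
  rw [if_pos rfl, hp, inner_gramMap_self_eq_zero_iff] at h1
  have h2 : b p ∈ (V A p.1)ᗮ := by
    rw [mem_V_orthogonal_iff]
    intro i hi
    rcases hi.eq_or_lt with rfl | hi
    · exact h1
    · exact (mem_prevV_orthogonal_iff A _ _).1 (hmem p).1 i hi
  have h3 : b p = 0 := by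
    have := Submodule.inf_orthogonal_eq_bot (V A p.1)
    rw [← Submodule.mem_bot ℝ, ← this]
    exact ⟨(hmem p).2, h2⟩
  exact b.toBasis.ne_zero p (by simpa using h3)

/-! ### The family and `Â_j` in an adapted basis -/

section AdaptedBasis

variable {A} {r : ℕ} {b : OrthonormalBasis (FlagIndex A r) ℝ (EuclideanSpace ℝ (Fin d))}
  {μ : FlagIndex A r → ℝ}

lemma gramMap_basis_eq_zero (hb : ∀ p, b p ∈ gradedV A p.1) (i : ℕ)
    (p : FlagIndex A r) (h : i < p.1) : gramMap A i (b p) = 0 :=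
  (mem_prevV_orthogonal_iff A _ _).1 (hb p).1 i h

lemma inner_gramMap_basis_eq_zero (hb : ∀ p, b p ∈ gradedV A p.1) (i : ℕ)
    (p q : FlagIndex A r)
    (h : i < max (p.1 : ℕ) (q.1 : ℕ)) : inner ℝ (gramMap A i (b q)) (b p) = 0 := by
  rcases lt_max_iff.1 h with h | h
  · rw [isSymmetric_gramMap, gramMap_basis_eq_zero hb i p h, inner_zero_right]
  · rw [gramMap_basis_eq_zero hb i q h, inner_zero_left]

/-- The condition `max ≤ i` keeps only terms that can be nonzero and makes the subtraction in the
exponent exact. Nothing is divided by `h`, so `h = 0` is included. -/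
lemma charpoly_gramFamily (hb : ∀ p, b p ∈ gradedV A p.1) (h : ℝ) :
    (gramFamily A r h).charpoly = (Matrix.of fun p q : FlagIndex A r =>
      h ^ ((p.1 : ℕ) + q.1) * ∑ i ∈ Finset.range (r + 1), if max (p.1 : ℕ) q.1 ≤ i then
        h ^ (2 * i - (p.1 + q.1)) * inner ℝ (gramMap A i (b q)) (b p) else 0).charpoly := by
  have h1 : (gramFamily A r h).charpoly =
      (Matrix.toEuclideanLin (gramFamily A r h)).charpoly := by
    rw [Matrix.toEuclideanLin_eq_toLin_orthonormal, Matrix.charpoly_toLin]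
  rw [h1, ← LinearMap.charpoly_toMatrix _ b.toBasis]
  congr 1
  ext p q
  have h2 : Matrix.toEuclideanLin (gramFamily A r h) =
      ∑ i ∈ Finset.range (r + 1), h ^ (2 * i) • gramMap A i := by
    simp [gramFamily, gramMap]
  rw [LinearMap.toMatrix_apply, h2, OrthonormalBasis.coe_toBasis,
    OrthonormalBasis.coe_toBasis_repr_apply, OrthonormalBasis.repr_apply_apply,
    LinearMap.sum_apply, inner_sum, Matrix.of_apply, Finset.mul_sum]
  refine Finset.sum_congr rfl fun i _ => ?_
  rw [LinearMap.smul_apply, real_inner_smul_right, ← real_inner_comm]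
  split_ifs with hi
  · rw [← mul_assoc, ← pow_add]
    congr 2
    have := max_le_iff.1 hi
    omega
  · rw [inner_gramMap_basis_eq_zero hb i p q (by omega), mul_zero, mul_zero]

/-- The nonzero eigenvalues of `Â_j` are the diagonal entries of the adapted basis in degree
`j`. -/
lemma filter_roots_charpoly_hatA (hb : ∀ p, b p ∈ gradedV A p.1) (hμ0 : ∀ p, μ p ≠ 0)
    (hμ : ∀ p q, p.1 = q.1 → inner ℝ (gramMap A q.1 (b q)) (b p) = if p = q then μ p else 0)
    (j : Fin (r + 1)) :
    (hatA A j).charpoly.roots.filter (· ≠ 0) =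
      Multiset.map (fun i => μ ⟨j, i⟩) Finset.univ.val := by
  classical
  have hmem : ∀ p : {p : FlagIndex A r // j ≤ p.1}, b p ∈ (prevV A j)ᗮ := by
    intro p
    rw [mem_prevV_orthogonal_iff]
    exact fun i hi => gramMap_basis_eq_zero hb i p (lt_of_lt_of_le hi p.2)
  -- The basis vectors of weight at least `j` form an orthonormal basis of `V_{j-1}^⊥`.
  let u : {p : FlagIndex A r // j ≤ p.1} → ↥(prevV A j)ᗮ := fun p => ⟨b p, hmem p⟩
  have hu : Orthonormal ℝ u := by
    have := b.orthonormal.comp (fun p : {p : FlagIndex A r // j ≤ p.1} => (p : FlagIndex A r))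
      Subtype.val_injective
    exact ⟨fun p => this.1 p, fun p q hpq => this.2 hpq⟩
  have huspan : (Submodule.span ℝ (Set.range u))ᗮ = ⊥ := by
    rw [Submodule.eq_bot_iff]
    intro v hv
    have h1 : ∀ p, inner ℝ (b p) (v : EuclideanSpace ℝ (Fin d)) = 0 := by
      intro p
      rcases le_or_gt j p.1 with hp | hp
      · exact (Submodule.mem_orthogonal _ _).1 hv (u ⟨p, hp⟩)
          (Submodule.subset_span (Set.mem_range_self _))
      · exact (Submodule.mem_orthogonal _ _).1 v.2 _ (V_le_prevV A hp (hb p).2)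
    apply Subtype.ext
    apply b.repr.injective
    ext p
    rw [OrthonormalBasis.repr_apply_apply, h1]
    simp
  let c := OrthonormalBasis.mkOfOrthogonalEqBot hu huspan
  have hc : ∀ p, c p = u p := fun p => by simp [c]
  -- `ᵗA_j A_j` kills basis vectors of weight above `j`, so only the diagonal block of weight `j`
  -- survives.
  have hmat : LinearMap.toMatrix c.toBasis c.toBasis (hatA A j) =
      Matrix.diagonal fun p : {p : FlagIndex A r // j ≤ p.1} => if p.1.1 = j then μ p else 0 := by
    ext p q
    rw [LinearMap.toMatrix_apply, OrthonormalBasis.coe_toBasis,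
      OrthonormalBasis.coe_toBasis_repr_apply, OrthonormalBasis.repr_apply_apply,
      ← real_inner_comm, hc, hc]
    have h1 : inner ℝ (hatA A j (u q)) (u p) = inner ℝ (gramMap A j (b q)) (b p) :=
      Submodule.inner_orthogonalProjectionOnto_eq_of_mem_right (u p) _
    rw [h1, Matrix.diagonal_apply]
    by_cases hpq : p.1.1 = j ∧ q.1.1 = j
    · have h2 := hμ p q (hpq.1.trans hpq.2.symm)
      rw [hpq.2] at h2
      rw [h2, if_pos hpq.1]
      simp [Subtype.ext_iff]
    · rw [inner_gramMap_basis_eq_zero hb]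
      · split_ifs with h2 h3
        · subst h2; exact absurd ⟨h3, h3⟩ hpq
        · rfl
        · rfl
      · have hp := p.2
        have hq := q.2
        rw [lt_max_iff]
        by_contra hcon
        push Not at hcon
        exact hpq ⟨le_antisymm hcon.1 hp, le_antisymm hcon.2 hq⟩
  rw [← LinearMap.charpoly_toMatrix (hatA A j) c.toBasis, hmat, Matrix.charpoly_diagonal]
  have hroots : ∀ f : {p : FlagIndex A r // j ≤ p.1} → ℝ,
      (∏ p, (X - C (f p))).roots = Multiset.map f Finset.univ.val := by
    intro f
    rw [← roots_multiset_prod_X_sub_C (Multiset.map f Finset.univ.val), Multiset.map_map]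
    rfl
  rw [hroots, Multiset.filter_map]
  let emb : Fin (increment (dimV A) j) ↪ {p : FlagIndex A r // j ≤ p.1} :=
    ⟨fun i => ⟨⟨j, i⟩, le_rfl⟩, fun i i' h => by simpa using h⟩
  have hfil : Finset.univ.filter (fun p : {p : FlagIndex A r // j ≤ p.1} =>
      (if p.1.1 = j then μ p else 0) ≠ 0) = Finset.univ.map emb := by
    ext ⟨⟨j', i⟩, hp⟩
    simp only [Finset.mem_filter, Finset.mem_univ, true_and, Finset.mem_map, emb]
    constructor
    · intro h
      have hj : j' = j := by by_contra hj; simp [hj] at h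
      subst hj
      exact ⟨i, rfl⟩
    · rintro ⟨i', h⟩
      have hj : j = j' := congrArg (fun p => p.1.1) h
      subst hj
      simpa using hμ0 _
  have hfil' := congrArg Finset.val hfil
  rw [Finset.filter_val, Finset.map_val] at hfil'
  have hcomp : Multiset.filter ((fun x => x ≠ 0) ∘ fun p : {p : FlagIndex A r // j ≤ p.1} =>
      if p.1.1 = j then μ p else 0) Finset.univ.val = Multiset.map emb Finset.univ.val := by
    rw [← hfil']; rfl
  rw [hcomp, Multiset.map_map]
  refine Multiset.map_congr rfl fun i _ => ?_
  exact if_pos rfl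

end AdaptedBasis

end MatrixFamily

/-! ### The spectrum of `∑ h^{2i} ᵗA_i A_i` -/

section MatrixFamily

variable {d : ℕ} {N : ℕ → ℕ} (A : ∀ i, Matrix (Fin (N i)) (Fin d) ℝ)

/-- The orthogonal complement of `V_r` is the common kernel of the `A_i`, which is the kernel of the
stacked matrix at `h = 1`. -/
lemma V_eq_top_of_rank {r : ℕ} (hA : (stackedMatrix A r 1).rank = d) : V A r = ⊤ := by
  rw [← Submodule.orthogonal_eq_bot_iff, Submodule.eq_bot_iff]
  intro v hv
  rw [mem_V_orthogonal_iff] at hv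
  have hker : LinearMap.ker (stackedMatrix A r 1).mulVecLin = ⊥ := by
    have h1 := LinearMap.finrank_range_add_finrank_ker (stackedMatrix A r 1).mulVecLin
    rw [Module.finrank_fin_fun] at h1
    rw [← Submodule.finrank_eq_zero (R := ℝ)]
    have h2 : finrank ℝ (LinearMap.range (stackedMatrix A r 1).mulVecLin) = d := hA
    omega
  have h0 : v.ofLp ∈ LinearMap.ker (stackedMatrix A r 1).mulVecLin := by
    rw [LinearMap.mem_ker, Matrix.mulVecLin_apply]
    ext ⟨i, k⟩
    have h1 := congrFun ((gramMap_eq_zero_iff A i v).1 (hv i (by omega))) k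
    simpa [stackedMatrix, Matrix.mulVec, dotProduct] using h1
  rw [hker, Submodule.mem_bot] at h0
  exact (WithLp.ofLp_injective 2) h0

lemma isHermitian_gramFamily (r : ℕ) (h : ℝ) : (gramFamily A r h).IsHermitian := by
  rw [Matrix.IsHermitian, Matrix.conjTranspose_eq_transpose_of_trivial, gramFamily,
    Matrix.transpose_sum]
  refine Finset.sum_congr rfl fun i _ => ?_
  rw [Matrix.transpose_smul, Matrix.transpose_mul, Matrix.transpose_transpose]

lemma hyperbolicAt_charpoly_gramFamily (r : ℕ) (h₀ : ℝ) :
    HyperbolicAt d (fun h => (gramFamily A r h).charpoly) h₀ := by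
  refine ⟨fun k => ?_, Filter.Eventually.of_forall fun h => ?_⟩
  -- The family is the evaluation at `h` of a matrix over `ℝ[X]`, so the coefficients of its
  -- characteristic polynomial are polynomials in `h`.
  · let B : Matrix (Fin d) (Fin d) ℝ[X] := ∑ i ∈ Finset.range (r + 1),
      (X : ℝ[X]) ^ (2 * i) • ((A i)ᵀ * A i).map C
    have hB : ∀ h, B.map (evalRingHom h) = gramFamily A r h := by
      intro h
      ext p q
      simp [B, gramFamily, Matrix.sum_apply, eval_finsetSum, -Matrix.map_mul]
      exact Finset.sum_congr rfl fun i _ => mul_comm _ _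
    have h1 : ∀ h, (gramFamily A r h).charpoly.coeff k = (B.charpoly.coeff k).eval h := by
      intro h
      rw [← hB, Matrix.charpoly_map, coeff_map, coe_evalRingHom]
    simp only [h1]
    exact AnalyticAt.aeval_polynomial analyticAt_id (B.charpoly.coeff k)
  · exact ⟨(isHermitian_gramFamily A r h).eigenvalues,
      by simpa [rootsPoly] using (isHermitian_gramFamily A r h).charpoly_eq⟩

theorem exists_analytic_eigenvalues_gramFamily {r : ℕ} (hr : V A r = ⊤) :
    ∃ η : (j : Fin (r + 1)) → Fin (increment (dimV A) j) → ℝ → ℝ,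
      (∀ j i, AnalyticOnNhd ℝ (η j i) Set.univ) ∧
      (∀ h : ℝ, (gramFamily A r h).charpoly =
        ∏ j : Fin (r + 1), ∏ i, (X - C (h ^ (2 * (j : ℕ)) * η j i h))) ∧
      (∀ j : Fin (r + 1), Multiset.map (fun i => η j i 0) Finset.univ.val =
        (hatA A j).charpoly.roots.filter (· ≠ 0)) := by
  obtain ⟨b, μ, hb, hμ0, hμ⟩ := exists_adapted_basis A hr
  obtain ⟨x, hx⟩ := exists_isRootsOn_univ (hyperbolicAt_charpoly_gramFamily A r)
  let m : ℝ → Matrix (FlagIndex A r) (FlagIndex A r) ℝ := fun h => Matrix.of fun p q =>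
    ∑ i ∈ Finset.range (r + 1), if max (p.1 : ℕ) q.1 ≤ i then
      h ^ (2 * i - (p.1 + q.1)) * inner ℝ (gramMap A i (b q)) (b p) else 0
  have hm : Continuous m := by
    refine continuous_pi fun p => continuous_pi fun q => ?_
    simp only [m, Matrix.of_apply]
    refine continuous_finsetSum _ fun i _ => ?_
    split_ifs
    · fun_prop
    · exact continuous_const
  -- For equal weights only `i = q.1` leaves the exponent `0`. For different weights `2 * i ≥ 2 *
  -- max` exceeds their sum, so every term vanishes at `h = 0`.
  have hm0 : m 0 = Matrix.diagonal μ := by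
    ext p q
    simp only [m, Matrix.of_apply, Matrix.diagonal_apply]
    by_cases hpq : p.1 = q.1
    · rw [← hμ p q hpq, Finset.sum_eq_single (q.1 : ℕ)]
      · rw [if_pos (by rw [hpq, max_self]), hpq, two_mul, Nat.sub_self, pow_zero, one_mul]
      · intro i _ hi
        split_ifs with h
        · have h1 := max_le_iff.1 h
          rw [hpq] at h1 ⊢
          rw [zero_pow (by omega), zero_mul]
        · rfl
      · intro h
        exact absurd (Finset.mem_range.2 q.1.2) h
    · rw [if_neg fun h => hpq (by rw [h])]
      refine Finset.sum_eq_zero fun i _ => ?_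
      split_ifs with h
      · have h1 := max_le_iff.1 h
        have h2 : (p.1 : ℕ) ≠ q.1 := fun h => hpq (Fin.ext h)
        rw [zero_pow (by omega), zero_mul]
      · rfl
  obtain ⟨e, η, hη, hη0, hxη⟩ := exists_equiv_order_leadingCoeff (fun p : FlagIndex A r => (p.1 : ℕ))
    m hm.continuousAt hm0 hμ0 x (fun k => hx.analyticOnNhd k 0 trivial)
    (Filter.Eventually.of_forall fun h => by
      rw [← rootsPoly, ← hx.eq_rootsPoly h trivial, charpoly_gramFamily hb]; rfl)
  choose ξ hξ hξ0 hxξ using fun p =>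
    exists_analyticOnNhd_of_eq_pow_mul (hx.analyticOnNhd (e p)) (hη p) (hxη p)
  refine ⟨fun j i => ξ ⟨j, i⟩, fun j i => hξ _, fun h => ?_, fun j => ?_⟩
  · rw [hx.eq_rootsPoly h trivial, rootsPoly, ← Equiv.prod_comp e, ← Finset.univ_sigma_univ,
      Finset.prod_sigma]
    exact Finset.prod_congr rfl fun j _ => Finset.prod_congr rfl fun i _ => by rw [hxξ]
  · rw [filter_roots_charpoly_hatA hb hμ0 hμ]
    exact Multiset.map_congr rfl fun i _ => ((hξ0 _).trans (hη0 _))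

end MatrixFamily

/-! ### The distributions are spanned by iterated brackets -/

section Structure

variable {d : ℕ} {M : Type*} [TopologicalSpace M] [ChartedSpace (EuclideanSpace ℝ (Fin d)) M]
  {N₀ : ℕ} {F : Fin N₀ → (m : M) → TangentSpace (𝓡 d) m}

variable (F) in
/-- The `C^∞(M)`-module spanned by the iterated brackets of length at most `i + 1`. -/
def bracketModule (i : ℕ) : Submodule ℝ ((m : M) → TangentSpace (𝓡 d) m) :=
  Submodule.span ℝ {W | ∃ (f : M → ℝ) (k : ℕ) (I : Fin (k + 1) → Fin N₀), k ≤ i ∧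
    ContMDiff (𝓡 d) 𝓘(ℝ, ℝ) ∞ f ∧ W = fun m => f m • iterBracket F k I m}

lemma bracketModule_mono : Monotone (bracketModule F) := by
  intro i j hij
  refine Submodule.span_mono ?_
  rintro W ⟨f, k, I, hk, h⟩
  exact ⟨f, k, I, hk.trans hij, h⟩

lemma smul_iterBracket_mem {f : M → ℝ} (hf : ContMDiff (𝓡 d) 𝓘(ℝ, ℝ) ∞ f) {i k : ℕ}
    (I : Fin (k + 1) → Fin N₀) (hk : k ≤ i) :
    (fun m => f m • iterBracket F k I m) ∈ bracketModule F i :=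
  Submodule.subset_span ⟨f, k, I, hk, hf, rfl⟩

lemma distribution₀_le_bracketModule : distribution₀ F ≤ bracketModule F 0 := by
  refine Submodule.span_mono ?_
  rintro W ⟨f, j, hf, rfl⟩
  exact ⟨f, 0, fun _ => j, le_rfl, hf, rfl⟩

lemma distribution_mono : Monotone (distribution F) := monotone_nat_of_le_succ fun _ => le_sup_left

lemma field_mem_distribution₀ (j : Fin N₀) : F j ∈ distribution₀ F :=
  Submodule.subset_span ⟨fun _ => 1, j, contMDiff_const, by simp⟩

lemma iterBracket_mem_distribution (k : ℕ) (I : Fin (k + 1) → Fin N₀) :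
    iterBracket F k I ∈ distribution F k := by
  induction k with
  | zero => exact field_mem_distribution₀ _
  | succ k ih =>
    exact Submodule.mem_sup_right (Submodule.subset_span
      ⟨_, field_mem_distribution₀ _, _, ih _, rfl⟩)

lemma distributionAt_mono (m : M) : Monotone fun i => distributionAt F i m :=
  fun _ _ h => Submodule.map_mono (distribution_mono h)

variable [IsManifold (𝓡 d) ∞ M]

/-- Smooth vector fields. -/
def IsSmoothField (W : (m : M) → TangentSpace (𝓡 d) m) : Prop :=
  ContMDiff (𝓡 d) (𝓡 d).tangent ∞ fun m => (⟨m, W m⟩ : TangentBundle (𝓡 d) M)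

lemma IsSmoothField.mdifferentiableAt {W : (m : M) → TangentSpace (𝓡 d) m} (hW : IsSmoothField W)
    (m : M) : MDifferentiableAt (𝓡 d) (𝓡 d).tangent
      (fun m => (⟨m, W m⟩ : TangentBundle (𝓡 d) M)) m :=
  (hW m).mdifferentiableAt (by simp)

lemma IsSmoothField.zero : IsSmoothField (0 : (m : M) → TangentSpace (𝓡 d) m) :=
  Bundle.contMDiff_zeroSection ℝ _

lemma IsSmoothField.add {W W' : (m : M) → TangentSpace (𝓡 d) m} (hW : IsSmoothField W)
    (hW' : IsSmoothField W') : IsSmoothField (W + W') :=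
  ContMDiff.add_section hW hW'

lemma IsSmoothField.smul {f : M → ℝ} {W : (m : M) → TangentSpace (𝓡 d) m}
    (hf : ContMDiff (𝓡 d) 𝓘(ℝ, ℝ) ∞ f) (hW : IsSmoothField W) :
    IsSmoothField fun m => f m • W m :=
  ContMDiff.smul_section hf hW

lemma IsSmoothField.const_smul (c : ℝ) {W : (m : M) → TangentSpace (𝓡 d) m}
    (hW : IsSmoothField W) : IsSmoothField (c • W) :=
  IsSmoothField.smul contMDiff_const hW

lemma IsSmoothField.mlieBracket {W W' : (m : M) → TangentSpace (𝓡 d) m} (hW : IsSmoothField W)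
    (hW' : IsSmoothField W') : IsSmoothField (VectorField.mlieBracket (𝓡 d) W W') := by
  have : IsManifold (𝓡 d) (((⊤ : ℕ∞) : WithTop ℕ∞) + 1) M := ‹IsManifold (𝓡 d) ∞ M›
  have : IsManifold (𝓡 d) (minSmoothness ℝ 2) M := by
    rw [minSmoothness_of_isRCLikeNormedField]
    infer_instance
  have : IsManifold (𝓡 d) (minSmoothness ℝ 3) M := by
    rw [minSmoothness_of_isRCLikeNormedField]
    infer_instance
  exact ContDiff.mlieBracket_vectorField (m := ⊤) (n := ⊤) hW hW' (by simp)

lemma IsSmoothField.contMDiff_mvfderiv {f : M → ℝ} {W : (m : M) → TangentSpace (𝓡 d) m}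
    (hf : ContMDiff (𝓡 d) 𝓘(ℝ, ℝ) ∞ f) (hW : IsSmoothField W) :
    ContMDiff (𝓡 d) 𝓘(ℝ, ℝ) ∞ fun m => mvfderiv (𝓡 d) f m (W m) := by
  have h1 : ContMDiff (𝓡 d) 𝓘(ℝ, ℝ).tangent ∞
      (fun m => tangentMap (𝓡 d) 𝓘(ℝ, ℝ) f ⟨m, W m⟩) :=
    (hf.contMDiff_tangentMap (m := ∞) (by simp)).comp hW
  exact (contMDiff_snd_tangentBundle_modelSpace ℝ 𝓘(ℝ, ℝ)).comp h1

lemma isSmoothField_iterBracket (hF : ∀ j, IsSmoothField (F j)) (k : ℕ) (I : Fin (k + 1) → Fin N₀) :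
    IsSmoothField (iterBracket F k I) := by
  induction k with
  | zero => exact hF _
  | succ k ih => exact (hF _).mlieBracket (ih _)

lemma isSmoothField_of_mem_bracketModule (hF : ∀ j, IsSmoothField (F j)) {i : ℕ}
    {W : (m : M) → TangentSpace (𝓡 d) m} (hW : W ∈ bracketModule F i) : IsSmoothField W := by
  induction hW using Submodule.span_induction with
  | mem W hW =>
    obtain ⟨f, k, I, -, hf, rfl⟩ := hW
    exact IsSmoothField.smul hf (isSmoothField_iterBracket hF k I)
  | zero => exact IsSmoothField.zero
  | add W W' _ _ h h' => exact h.add h'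
  | smul c W _ h => exact h.const_smul c

/-- Leibniz: `[fY, gZ] = -g (Zf) Y + f (Yg) Z + fg [Y, Z]`, with smooth coefficients; the last
bracket is an iterated bracket one step longer. -/
lemma mlieBracket_smul_iterBracket (hF : ∀ j, IsSmoothField (F j)) {f g : M → ℝ}
    (hf : ContMDiff (𝓡 d) 𝓘(ℝ, ℝ) ∞ f) (hg : ContMDiff (𝓡 d) 𝓘(ℝ, ℝ) ∞ g) {i k : ℕ} (hk : k ≤ i)
    (I₀ : Fin 1 → Fin N₀) (I : Fin (k + 1) → Fin N₀) :
    VectorField.mlieBracket (𝓡 d) (fun m => f m • iterBracket F 0 I₀ m)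
      (fun m => g m • iterBracket F k I m) ∈ bracketModule F (i + 1) := by
  set Y := iterBracket F 0 I₀ with hYdef
  set Z := iterBracket F k I with hZdef
  have hY : IsSmoothField Y := isSmoothField_iterBracket hF 0 I₀
  have hZ : IsSmoothField Z := isSmoothField_iterBracket hF k I
  have h1 : VectorField.mlieBracket (𝓡 d) (fun m => f m • Y m) (fun m => g m • Z m) =
      (fun m => (-(g m * mvfderiv (𝓡 d) f m (Z m))) • Y m) +
        (fun m => (f m * mvfderiv (𝓡 d) g m (Y m)) • Z m) +
        fun m => (f m * g m) • iterBracket F (k + 1) (Fin.cons (I₀ 0) I) m := by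
    funext m
    have h2 := VectorField.mlieBracket_smul_left (I := 𝓡 d) (V := Y) (W := fun m => g m • Z m)
      ((hf m).mdifferentiableAt (by simp)) (hY.mdifferentiableAt m)
    have h3 := VectorField.mlieBracket_smul_right (I := 𝓡 d) (V := Y) (W := Z)
      ((hg m).mdifferentiableAt (by simp)) (hZ.mdifferentiableAt m)
    refine h2.trans ?_
    have h4 : VectorField.mlieBracket (𝓡 d) Y (fun m => g m • Z m) m =
      mvfderiv (𝓡 d) g m (Y m) • Z m + g m • VectorField.mlieBracket (𝓡 d) Y Z m := h3
    have h5 : iterBracket F (k + 1) (Fin.cons (I₀ 0) I) m =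
      VectorField.mlieBracket (𝓡 d) Y Z m := rfl
    rw [h4, Pi.add_apply, Pi.add_apply, h5, map_smul, smul_eq_mul, smul_add, smul_smul, smul_smul]
    abel
  rw [h1]
  refine Submodule.add_mem _ (Submodule.add_mem _ ?_ ?_) ?_
  · exact smul_iterBracket_mem (hg.mul (IsSmoothField.contMDiff_mvfderiv hf hZ)).neg I₀
      (Nat.zero_le _)
  · exact smul_iterBracket_mem (hf.mul (IsSmoothField.contMDiff_mvfderiv hg hY)) I (by omega)
  · exact smul_iterBracket_mem (hf.mul hg) _ (by omega)

/-- Bilinearity reduces to generators. Smoothness is carried along because additivity of the bracket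
needs differentiable fields. -/
lemma mlieBracket_mem_bracketModule (hF : ∀ j, IsSmoothField (F j)) {i : ℕ}
    {Y Z : (m : M) → TangentSpace (𝓡 d) m} (hY : Y ∈ bracketModule F 0)
    (hZ : Z ∈ bracketModule F i) :
    VectorField.mlieBracket (𝓡 d) Y Z ∈ bracketModule F (i + 1) := by
  have hZs := isSmoothField_of_mem_bracketModule hF hZ
  induction hY using Submodule.span_induction with
  | zero => rw [VectorField.mlieBracket_zero_left]; exact Submodule.zero_mem _
  | add Y Y' hY hY' h h' =>
    have hs := isSmoothField_of_mem_bracketModule hF hY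
    have hs' := isSmoothField_of_mem_bracketModule hF hY'
    have : VectorField.mlieBracket (𝓡 d) (Y + Y') Z =
        VectorField.mlieBracket (𝓡 d) Y Z + VectorField.mlieBracket (𝓡 d) Y' Z :=
      funext fun m => VectorField.mlieBracket_add_left (hs.mdifferentiableAt m)
        (hs'.mdifferentiableAt m)
    rw [this]; exact Submodule.add_mem _ h h'
  | smul c Y hY h =>
    have hs := isSmoothField_of_mem_bracketModule hF hY
    have : VectorField.mlieBracket (𝓡 d) (c • Y) Z = c • VectorField.mlieBracket (𝓡 d) Y Z :=
      funext fun m => VectorField.mlieBracket_const_smul_left (hs.mdifferentiableAt m)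
    rw [this]; exact Submodule.smul_mem _ _ h
  | mem Y hY =>
    obtain ⟨f, k₀, I₀, hk₀, hf, rfl⟩ := hY
    obtain rfl : k₀ = 0 := by omega
    clear hZs
    induction hZ using Submodule.span_induction with
    | zero => rw [VectorField.mlieBracket_zero_right]; exact Submodule.zero_mem _
    | add Z Z' hZ hZ' h h' =>
      have hs := isSmoothField_of_mem_bracketModule hF hZ
      have hs' := isSmoothField_of_mem_bracketModule hF hZ'
      have : VectorField.mlieBracket (𝓡 d) (fun m => f m • iterBracket F 0 I₀ m) (Z + Z') =
          VectorField.mlieBracket (𝓡 d) (fun m => f m • iterBracket F 0 I₀ m) Z +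
          VectorField.mlieBracket (𝓡 d) (fun m => f m • iterBracket F 0 I₀ m) Z' :=
        funext fun m => VectorField.mlieBracket_add_right (hs.mdifferentiableAt m)
          (hs'.mdifferentiableAt m)
      rw [this]; exact Submodule.add_mem _ h h'
    | smul c Z hZ h =>
      have hs := isSmoothField_of_mem_bracketModule hF hZ
      have : VectorField.mlieBracket (𝓡 d) (fun m => f m • iterBracket F 0 I₀ m) (c • Z) =
          c • VectorField.mlieBracket (𝓡 d) (fun m => f m • iterBracket F 0 I₀ m) Z :=
        funext fun m => VectorField.mlieBracket_const_smul_right (hs.mdifferentiableAt m)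
      rw [this]; exact Submodule.smul_mem _ _ h
    | mem Z hZ =>
      obtain ⟨g, k, I, hk, hg, rfl⟩ := hZ
      exact mlieBracket_smul_iterBracket hF hf hg hk I₀ I

lemma distribution_le_bracketModule (hF : ∀ j, IsSmoothField (F j)) (i : ℕ) :
    distribution F i ≤ bracketModule F i := by
  induction i with
  | zero => exact distribution₀_le_bracketModule
  | succ i ih =>
    refine sup_le (ih.trans (bracketModule_mono i.le_succ)) (Submodule.span_le.2 ?_)
    rintro W ⟨Y, hY, Z, hZ, rfl⟩
    exact mlieBracket_mem_bracketModule hF (distribution₀_le_bracketModule hY) (ih hZ)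

/-- The space `D_i(m)` is spanned by the values at `m` of the iterated brackets. -/
lemma distributionAt_eq_span (hF : ∀ j, IsSmoothField (F j)) (i : ℕ) (m : M) :
    distributionAt F i m =
      Submodule.span ℝ {v | ∃ (k : ℕ) (I : BracketIndex F k), k ≤ i ∧ v = iterBracket F k I.1 m} := by
  apply le_antisymm
  · refine (Submodule.map_mono (distribution_le_bracketModule hF i)).trans ?_
    rw [bracketModule, Submodule.map_span, Submodule.span_le]
    rintro _ ⟨W, ⟨f, k, I, hk, -, rfl⟩, rfl⟩
    refine Submodule.smul_mem _ _ ?_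
    -- A bracket that is nonzero at `m` belongs to `C_k`; one that vanishes at `m` contributes
    -- nothing to the span.
    by_cases h0 : iterBracket F k I m = 0
    · rw [h0]; exact Submodule.zero_mem _
    · exact Submodule.subset_span ⟨k, ⟨I, Or.inr ⟨m, h0⟩⟩, hk, rfl⟩
  · rw [Submodule.span_le]
    rintro _ ⟨k, I, hk, rfl⟩
    exact ⟨_, distribution_mono hk (iterBracket_mem_distribution k I.1), rfl⟩

end Structure

/-! ### The approximating metrics -/

section Structure

variable {d : ℕ} {M : Type*} [TopologicalSpace M] [ChartedSpace (EuclideanSpace ℝ (Fin d)) M]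

lemma isLocalDiffeomorphAt_of_mem_maximalAtlas [IsManifold (𝓡 d) ∞ M]
    {x : OpenPartialHomeomorph M (EuclideanSpace ℝ (Fin d))}
    (hx : x ∈ IsManifold.maximalAtlas (𝓡 d) ∞ M) {m : M} (hm : m ∈ x.source) :
    IsLocalDiffeomorphAt (𝓡 d) (𝓡 d) ∞ x m :=
  ⟨{ x.toPartialEquiv with
      open_source := x.open_source
      open_target := x.open_target
      contMDiffOn_toFun := contMDiffOn_of_mem_maximalAtlas hx
      contMDiffOn_invFun := contMDiffOn_symm_of_mem_maximalAtlas hx }, hm, fun _ _ => rfl⟩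

lemma exists_equiv_coordVector [IsManifold (𝓡 d) ∞ M]
    {x : OpenPartialHomeomorph M (EuclideanSpace ℝ (Fin d))}
    (hx : x ∈ IsManifold.maximalAtlas (𝓡 d) ∞ M) {m : M} (hm : m ∈ x.source) :
    ∃ L : TangentSpace (𝓡 d) m ≃ₗ[ℝ] EuclideanSpace ℝ (Fin d),
      ∀ i, L (coordVector x m i) = EuclideanSpace.single i (1 : ℝ) := by
  let L := (isLocalDiffeomorphAt_of_mem_maximalAtlas hx hm).mfderivToContinuousLinearEquiv
    (by simp)
  refine ⟨L.toLinearEquiv, fun i => ?_⟩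
  have h1 : mfderiv (𝓡 d) (𝓡 d) x m = L := rfl
  have h2 : coordVector x m i = L.symm (EuclideanSpace.single i (1 : ℝ)) := by
    rw [coordVector, h1, ContinuousLinearMap.inverse_equiv]
    rfl
  rw [h2]
  exact L.apply_symm_apply _

variable {N₀ : ℕ} (F : Fin N₀ → (m : M) → TangentSpace (𝓡 d) m) {m : M}
  (L : TangentSpace (𝓡 d) m ≃ₗ[ℝ] EuclideanSpace ℝ (Fin d))

/-- The matrix whose rows are the coordinates of the iterated brackets of length `k + 1`. -/
def bracketMatrix (k : ℕ) : Matrix (Fin (Fintype.card (BracketIndex F k))) (Fin d) ℝ :=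
  Matrix.of fun a => (L (iterBracket F k ((Fintype.equivFin _).symm a).1 m)).ofLp

lemma bracketMatrix_mulVec (k : ℕ) (I : BracketIndex F k) (w : Fin d → ℝ) :
    (bracketMatrix F L k *ᵥ w) (Fintype.equivFin _ I) = (L (iterBracket F k I.1 m)).ofLp ⬝ᵥ w := by
  simp [bracketMatrix, Matrix.mulVec]

/-- Both sides have the same orthogonal complement: the vectors orthogonal to every bracket of
length at most `j + 1`. -/
lemma V_bracketMatrix (j : ℕ) : V (bracketMatrix F L) j =
    Submodule.span ℝ {v | ∃ (k : ℕ) (I : BracketIndex F k), k ≤ j ∧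
      v = L (iterBracket F k I.1 m)} := by
  rw [← Submodule.orthogonal_orthogonal (V (bracketMatrix F L) j),
    ← Submodule.orthogonal_orthogonal (Submodule.span ℝ _)]
  congr 1
  ext v
  rw [mem_V_orthogonal_iff, Submodule.mem_orthogonal]
  have hinner : ∀ u : EuclideanSpace ℝ (Fin d), inner ℝ u v = u.ofLp ⬝ᵥ v.ofLp := fun u => by
    rw [EuclideanSpace.inner_eq_star_dotProduct, star_trivial, dotProduct_comm]
  constructor
  · intro h u hu
    induction hu using Submodule.span_induction with
    | zero => exact inner_zero_left _
    | add u u' _ _ hu hu' => rw [inner_add_left, hu, hu', add_zero]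
    | smul c u _ hu => rw [real_inner_smul_left, hu, mul_zero]
    | mem u hu =>
      obtain ⟨k, I, hk, rfl⟩ := hu
      rw [hinner, ← bracketMatrix_mulVec, (gramMap_eq_zero_iff _ _ _).1 (h k hk)]
      rfl
  · intro h k hk
    rw [gramMap_eq_zero_iff]
    ext a
    obtain ⟨I, rfl⟩ := (Fintype.equivFin (BracketIndex F k)).surjective a
    rw [bracketMatrix_mulVec, ← hinner]
    exact h _ (Submodule.subset_span ⟨k, I, hk, rfl⟩)

lemma dimV_bracketMatrix [IsManifold (𝓡 d) ∞ M] (hF : ∀ j, IsSmoothField (F j)) :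
    dimV (bracketMatrix F L) = growth F m := by
  funext j
  have hset : {v | ∃ (k : ℕ) (I : BracketIndex F k), k ≤ j ∧ v = L (iterBracket F k I.1 m)} =
      L '' {v | ∃ (k : ℕ) (I : BracketIndex F k), k ≤ j ∧ v = iterBracket F k I.1 m} := by
    ext v
    constructor
    · rintro ⟨k, I, hk, rfl⟩
      exact ⟨_, ⟨k, I, hk, rfl⟩, rfl⟩
    · rintro ⟨_, ⟨k, I, hk, rfl⟩, rfl⟩
      exact ⟨k, I, hk, rfl⟩
  have hmap : V (bracketMatrix F L) j = (distributionAt F j m).map (L : _ →ₗ[ℝ] _) := by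
    rw [V_bracketMatrix, hset, distributionAt_eq_span hF, Submodule.map_span]
    rfl
  rw [dimV, growth, hmap]
  exact LinearEquiv.finrank_map_eq L _

lemma gramFamily_bracketMatrix_mulVec (r : ℕ) (h : ℝ) (w : Fin d → ℝ) :
    gramFamily (bracketMatrix F L) r h *ᵥ w = ∑ k : Fin (r + 1), ∑ I : BracketIndex F k,
      (h ^ (2 * (k : ℕ)) * ((L (iterBracket F k I.1 m)).ofLp ⬝ᵥ w)) •
        (L (iterBracket F k I.1 m)).ofLp := by
  rw [gramFamily, Matrix.sum_mulVec, Finset.sum_range]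
  refine Finset.sum_congr rfl fun k _ => ?_
  rw [Matrix.smul_mulVec, ← Matrix.mulVec_mulVec]
  simp only [← smul_smul, ← Finset.smul_sum, ← bracketMatrix_mulVec]
  congr 1
  ext c
  rw [Matrix.mulVec, dotProduct, ← (Fintype.equivFin (BracketIndex F k)).sum_comp,
    Finset.sum_apply]
  refine Finset.sum_congr rfl fun I _ => ?_
  simp [bracketMatrix, mul_comm]

lemma posDef_gramFamily {N : ℕ → ℕ} (A : ∀ i, Matrix (Fin (N i)) (Fin d) ℝ) {r : ℕ}
    (hr : V A r = ⊤) {h : ℝ} (hh : h ≠ 0) : (gramFamily A r h).PosDef := by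
  have key : ∀ w : Fin d → ℝ, w ⬝ᵥ (gramFamily A r h *ᵥ w) =
      ∑ i ∈ Finset.range (r + 1), h ^ (2 * i) * ((A i *ᵥ w) ⬝ᵥ (A i *ᵥ w)) := by
    intro w
    rw [gramFamily, Matrix.sum_mulVec, dotProduct_sum]
    refine Finset.sum_congr rfl fun i _ => ?_
    rw [Matrix.smul_mulVec, dotProduct_smul, smul_eq_mul, ← Matrix.mulVec_mulVec,
      Matrix.dotProduct_mulVec, Matrix.vecMul_transpose]
  refine Matrix.PosDef.of_dotProduct_mulVec_pos (isHermitian_gramFamily A r h) fun w hw => ?_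
  rw [star_trivial, key]
  have hnn : ∀ i ∈ Finset.range (r + 1), 0 ≤ h ^ (2 * i) * ((A i *ᵥ w) ⬝ᵥ (A i *ᵥ w)) :=
    fun i _ => mul_nonneg (by rw [pow_mul]; positivity)
      (Finset.sum_nonneg fun _ _ => mul_self_nonneg _)
  refine lt_of_le_of_ne (Finset.sum_nonneg hnn) fun h0 => hw ?_
  have h1 := (Finset.sum_eq_zero_iff_of_nonneg hnn).1 h0.symm
  have h2 : WithLp.toLp 2 w ∈ (V A r)ᗮ := by
    rw [mem_V_orthogonal_iff]
    intro i hi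
    rw [gramMap_eq_zero_iff]
    exact dotProduct_self_eq_zero.1 ((mul_eq_zero.1 (h1 i (Finset.mem_range.2
      (by omega)))).resolve_left (pow_ne_zero _ hh))
  rw [hr, Submodule.top_orthogonal_eq_bot, Submodule.mem_bot] at h2
  simpa using congrArg WithLp.ofLp h2

/-- The infimum that defines `g^h` is attained, with value given by the inverse Gram matrix. -/
lemma metric_eq {r : ℕ} {h : ℝ} (hh : h ≠ 0)
    (hdet : IsUnit (gramFamily (bracketMatrix F L) r h).det) (v : TangentSpace (𝓡 d) m) :
    metric F r h m v =
      (L v).ofLp ⬝ᵥ ((gramFamily (bracketMatrix F L) r h)⁻¹ *ᵥ (L v).ofLp) := by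
  set K := gramFamily (bracketMatrix F L) r h with hK
  set w := K⁻¹ *ᵥ (L v).ofLp with hw
  have hKw : K *ᵥ w = (L v).ofLp := by
    rw [hw, Matrix.mulVec_mulVec, Matrix.mul_nonsing_inv _ hdet, Matrix.one_mulVec]
  let a : (k : Fin (r + 1)) → BracketIndex F k → ℝ := fun k I =>
    (L (iterBracket F k I.1 m)).ofLp ⬝ᵥ w
  have hLσ : ∀ u, (L (sigmaMap F r m u)).ofLp = ∑ k : Fin (r + 1), ∑ I : BracketIndex F k,
      u k I • (L (iterBracket F k I.1 m)).ofLp := by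
    intro u
    simp [sigmaMap, map_sum, WithLp.ofLp_sum]
  have hpair : ∀ u, sigmaMap F r m u = v →
      (L v).ofLp ⬝ᵥ w = ∑ k : Fin (r + 1), ∑ I : BracketIndex F k, u k I * a k I := by
    intro u hu
    rw [← hu, hLσ]
    simp only [sum_dotProduct, smul_dotProduct, smul_eq_mul, a]
  -- The minimizer given by Lagrange multipliers, `w` being the multiplier; it is admissible because
  -- `K *ᵥ w` is `L v`.
  let u₀ : (k : Fin (r + 1)) → BracketIndex F k → ℝ := fun k I => h ^ (2 * (k : ℕ)) * a k I
  have hu₀ : sigmaMap F r m u₀ = v := by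
    apply L.injective
    apply WithLp.ofLp_injective 2
    rw [hLσ, ← hKw, hK, gramFamily_bracketMatrix_mulVec]
  have hpow : ∀ k : ℕ, h⁻¹ ^ k * h ^ k = 1 := fun k => by
    rw [← mul_pow, inv_mul_cancel₀ hh, one_pow]
  refine IsLeast.csInf_eq ⟨⟨u₀, hu₀, ?_⟩, ?_⟩
  · rw [hpair u₀ hu₀, dilatedNormSq]
    refine Finset.sum_congr rfl fun k _ => Finset.sum_congr rfl fun I _ => ?_
    simp only [u₀]
    have h1 := hpow k
    have h2 : h⁻¹ ^ (k : ℕ) * (h ^ (2 * (k : ℕ)) * a k I) = h ^ (k : ℕ) * a k I := by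
      rw [two_mul, pow_add, ← mul_assoc, ← mul_assoc, h1, one_mul]
    rw [h2]; ring
  · rintro c ⟨u, hu, rfl⟩
    -- Every admissible `u` has the same pairing with `a` as `u₀`. With `s = h⁻¹ ^ k * u` and `t = h
    -- ^ k * a` the summand is `2st - t²`, at most `s²`.
    have h3 : (L v).ofLp ⬝ᵥ w = ∑ k : Fin (r + 1), ∑ I : BracketIndex F k,
        (2 * (u k I * a k I) - u₀ k I * a k I) := by
      simp only [Finset.sum_sub_distrib, ← Finset.mul_sum]
      rw [← hpair u hu, ← hpair u₀ hu₀]; ring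
    rw [h3, dilatedNormSq]
    refine Finset.sum_le_sum fun k _ => Finset.sum_le_sum fun I _ => ?_
    have h1 := hpow k
    have h4 : u k I * a k I = (h⁻¹ ^ (k : ℕ) * u k I) * (h ^ (k : ℕ) * a k I) := by
      linear_combination -(u k I * a k I) * h1
    have h5 : u₀ k I * a k I = (h ^ (k : ℕ) * a k I) ^ 2 := by simp only [u₀]; ring
    rw [h4, h5]
    nlinarith [sq_nonneg (h⁻¹ ^ (k : ℕ) * u k I - h ^ (k : ℕ) * a k I)]

lemma metricMatrix_eq {r : ℕ} {h : ℝ} (hh : h ≠ 0)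
    (hdet : IsUnit (gramFamily (bracketMatrix F L) r h).det)
    {x : OpenPartialHomeomorph M (EuclideanSpace ℝ (Fin d))}
    (hL : ∀ i, L (coordVector x m i) = EuclideanSpace.single i (1 : ℝ)) :
    metricMatrix F r x m h = (gramFamily (bracketMatrix F L) r h)⁻¹ := by
  set K := gramFamily (bracketMatrix F L) r h with hK
  have hsymm : (K⁻¹)ᵀ = K⁻¹ := by
    have := (isHermitian_gramFamily (bracketMatrix F L) r h).inv
    rwa [Matrix.IsHermitian, Matrix.conjTranspose_eq_transpose_of_trivial] at this
  ext i j
  have h1 : K⁻¹ j i = K⁻¹ i j := by conv_lhs => rw [← hsymm, Matrix.transpose_apply]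
  rw [metricMatrix, Matrix.of_apply, QuadraticMap.polar, metric_eq F L hh hdet,
    metric_eq F L hh hdet, metric_eq F L hh hdet, map_add, hL, hL]
  simp only [WithLp.ofLp_add, PiLp.ofLp_single, Matrix.mulVec_add, add_dotProduct,
    dotProduct_add, Matrix.mulVec_single_one, single_one_dotProduct, Matrix.col_apply]
  rw [← hK, h1]; ring

end Structure

end SubRiemannian

end

/-! ### The two main statements -/

theorem mainTheorem7 :
    -- the general theorem on `∑ h^{2i} ᵗA_i A_i`
    (∀ (d r : ℕ) (N : ℕ → ℕ) (A : ∀ i, Matrix (Fin (N i)) (Fin d) ℝ),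
      (∀ h : ℝ, 0 < h → (SubRiemannian.stackedMatrix A r h).rank = d) →
      SubRiemannian.dimV A r = d ∧
      ∃ η : (j : Fin (r + 1)) → Fin (SubRiemannian.increment (SubRiemannian.dimV A) j) → ℝ → ℝ,
        (∀ j i, AnalyticOnNhd ℝ (η j i) Set.univ) ∧
        (∀ h : ℝ, (SubRiemannian.gramFamily A r h).charpoly =
          ∏ j : Fin (r + 1), ∏ i, (X - C (h ^ (2 * (j : ℕ)) * η j i h))) ∧
        (∀ j : Fin (r + 1), Multiset.map (fun i => η j i 0) Finset.univ.val =
          (SubRiemannian.hatA A j).charpoly.roots.filter (· ≠ 0))) ∧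
    -- the spectrum of the inverse Gram matrix of the approximating metrics
    (∀ (d : ℕ) (M : Type*) [TopologicalSpace M] [ChartedSpace (EuclideanSpace ℝ (Fin d)) M]
      [IsManifold (𝓡 d) ∞ M] (N₀ : ℕ) (F : Fin N₀ → (m : M) → TangentSpace (𝓡 d) m) (r : ℕ),
      (∀ j, ContMDiff (𝓡 d) (𝓡 d).tangent ∞
        (fun m => (⟨m, F j m⟩ : TangentBundle (𝓡 d) M))) →
      (∀ m : M, ∃ k, SubRiemannian.distributionAt F k m = ⊤) →
      IsGreatest (Set.range (SubRiemannian.localStep F)) r →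
      ∀ x ∈ IsManifold.maximalAtlas (𝓡 d) ∞ M, ∀ m ∈ x.source,
      (∀ h : ℝ, 0 < h → (SubRiemannian.metricMatrix F r x m h).PosDef) ∧
      SubRiemannian.growth F m r = d ∧
      ∃ η : (j : Fin (r + 1)) → Fin (SubRiemannian.increment (SubRiemannian.growth F m) j) →
          ℝ → ℝ,
        (∀ j i, AnalyticOnNhd ℝ (η j i) Set.univ) ∧
        (∀ h : ℝ, 0 < h → (SubRiemannian.metricMatrix F r x m h)⁻¹.charpoly =
          ∏ j : Fin (r + 1), ∏ i, (X - C (h ^ (2 * (j : ℕ)) * η j i h))) ∧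
        (∀ j i, η j i 0 ≠ 0)) := by
  refine ⟨fun d r N A hA => ?_, fun d M _ _ _ N₀ F r hF hspan hr x hx m hm => ?_⟩
  · have hr := SubRiemannian.V_eq_top_of_rank A (hA 1 one_pos)
    refine ⟨?_, SubRiemannian.exists_analytic_eigenvalues_gramFamily A hr⟩
    rw [SubRiemannian.dimV, hr, finrank_top, finrank_euclideanSpace_fin]
  · obtain ⟨L, hL⟩ := SubRiemannian.exists_equiv_coordVector hx hm
    have hdim : SubRiemannian.dimV (SubRiemannian.bracketMatrix F L) =
        SubRiemannian.growth F m := SubRiemannian.dimV_bracketMatrix F L hF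
    have htop : SubRiemannian.distributionAt F r m = ⊤ := by
      -- `hspan` makes the set nonempty, so `localStep` is a true minimum rather than the default
      -- value `0` of `sInf ∅`.
      have h1 : SubRiemannian.distributionAt F (SubRiemannian.localStep F m) m = ⊤ :=
        Nat.sInf_mem (hspan m)
      rw [eq_top_iff, ← h1]
      exact SubRiemannian.distributionAt_mono m (hr.2 (Set.mem_range_self m))
    have hgrowth : SubRiemannian.growth F m r = d := by
      rw [SubRiemannian.growth, htop, finrank_top]
      exact finrank_euclideanSpace_fin
    have hV : SubRiemannian.V (SubRiemannian.bracketMatrix F L) r = ⊤ := by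
      apply Submodule.eq_top_of_finrank_eq
      rw [finrank_euclideanSpace_fin]
      exact (congrFun hdim r).trans hgrowth
    have hpos : ∀ h : ℝ, 0 < h →
        (SubRiemannian.gramFamily (SubRiemannian.bracketMatrix F L) r h).PosDef :=
      fun h hh => SubRiemannian.posDef_gramFamily _ hV hh.ne'
    have hmat : ∀ h : ℝ, 0 < h → SubRiemannian.metricMatrix F r x m h =
        (SubRiemannian.gramFamily (SubRiemannian.bracketMatrix F L) r h)⁻¹ := fun h hh =>
      SubRiemannian.metricMatrix_eq F L hh.ne' (hpos h hh).det_pos.ne'.isUnit hL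
    refine ⟨fun h hh => ?_, hgrowth, ?_⟩
    · rw [hmat h hh]
      exact (hpos h hh).inv
    · obtain ⟨η, hη, hηe, hη0⟩ := SubRiemannian.exists_analytic_eigenvalues_gramFamily
        (SubRiemannian.bracketMatrix F L) hV
      rw [← hdim]
      refine ⟨η, hη, fun h hh => ?_, fun j i => ?_⟩
      · rw [hmat h hh, Matrix.nonsing_inv_nonsing_inv _ (hpos h hh).det_pos.ne'.isUnit, hηe]
      · have h1 : η j i 0 ∈ Multiset.map (fun i => η j i 0) Finset.univ.val :=
          Multiset.mem_map_of_mem _ (Finset.mem_univ_val i)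
        rw [hη0, Multiset.mem_filter] at h1
        exact h1.2
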